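/- **Theorem (Finite expectation of distance).** Let $\mathcal G$ be a separable (Hausdorff) real Banach-Lie group with identity $e$, Lie algebra $\mathfrak g=T_e\mathcal G$ (with the norm of the model Banach space) and exponential map $\exp:\mathfrak g\to\mathcal G$. For $\delta>0$ put $B_\delta=\{X\in\mathfrak g:\|X\|<\delta\}$ and $U_\delta=\exp(B_\delta)$. For $V\subseteq\mathcal G$ put $V^0=\{e\}$ and $V^m=\{g_1\cdots g_m: g_1,\dots,g_m\in V\}$. Let $(\Omega,\mathcal F,\mathbb P)$ be a complete probability space with an additive filtration $(\mathcal F^s_t)_{0\le s\le t<\infty}$, i.e. $\sigma$-algebras $\mathcal F^s_t\subseteq\mathcal F$ such that, for $s\le t\le u\le v$, $\mathcal F^s_t$ and $\mathcal F^u_v$ are independent and $\mathcal F^t_u\subseteq\mathcal F^s_v$; moreover each $\mathcal F^s_t$ contains all $\mathbb P$-null sets and $\mathcal F^s_t=\bigcap_{t'>t}\mathcal F^s_{t'}$. Let $x=(x^s_t)_{0\le s\le t<\infty}$ be a $\mathcal G$-valued multiplicative process with respect to $(\mathcal F^s_t)$, that is: 1. $x^s_t$ is $\mathcal F^s_t$-measurable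 for all $s\le t$; 2. $x^s_s=e$ almost surely for all $s$, and $x^s_tx^t_u=x^s_u$ almost surely for all $s\le t\le u$; 3. $x$ is stochastically continuous: for all $s\le t$ and every open $U\ni e$, $\mathbb P\big((x^s_t)^{-1}x^{s'}_{t'}\in U\big)\to1$ as $(s',t')\to(s,t)$ with $0\le s'\le t'$. Suppose that the paths of $x$ are almost surely càdlàg in both arguments (for every $s$, $t\mapsto x^s_t$ is càdlàg on $[s,\infty)$, and for every $t$, $s\mapsto x^s_t$ is càdlàg on $[0,t]$), and that $x$ has bounded jumps: there are $\delta>0$ and $n\in\mathbb N$ such that almost surely, for all $t>0$, $x^{t-}_t:=\lim_{s\uparrow t}x^s_t\in(U_\delta)^n$. Then for all $0<r<u$, every $\alpha\in\mathbb R$ and every open $V\subseteq\mathcal G$ with $e\in V$, the function $$\sup_{r<s<t<u}\exp\big(\alpha\cdot\inf\{m\in\mathbb N_0: x^s_t\in V^m\}\big)$$ on $\Omega$, with values in $[0,\infty]$, is measurable, and $$\mathbb E\Big[\sup_{r<s<t<u}\exp\big(\alpha\cdot\inf\{m\in\mathbb N_0: x^s_t\in V^m\}\big)\Big]<\infty .$$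 Here $\inf\emptyset=\infty$, $e^{\infty}=\infty$, $e^{-\infty}=0$ and $0\cdot\infty=0$. -/

import Mathlib

open MeasureTheory ProbabilityTheory Filter Set Topology
open scoped NNReal ENNReal Manifold Pointwise

noncomputable section

section LieGroupExp

variable {E : Type*} [NormedAddCommGroup E] [NormedSpace ℝ E]
  {G : Type*} [TopologicalSpace G] [ChartedSpace E G] [Group G]

/-- `γ` is a smooth one-parameter subgroup of `G` with initial velocity `X ∈ T_e G`. -/
structure IsOneParameterSubgroup (X : GroupLieAlgebra 𝓘(ℝ, E) G) (γ : ℝ → G) : Prop where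
  map_add : ∀ a b : ℝ, γ (a + b) = γ a * γ b
  smooth : ContMDiff 𝓘(ℝ, ℝ) 𝓘(ℝ, E) (⊤ : ℕ∞) γ
  velocity : (mfderiv 𝓘(ℝ, ℝ) 𝓘(ℝ, E) γ 0 (1 : ℝ) : E) = X

open Classical in
/-- The exponential map `T_e G → G` of a Banach-Lie group: `exp X = γ 1`, where `γ` is the smooth
one-parameter subgroup with velocity `X` at time `0`. (In a Banach-Lie group there is exactly one
such `γ`, so that the `else` branch is never used.) -/
def lieExp (X : GroupLieAlgebra 𝓘(ℝ, E) G) : G :=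
  if h : ∃ γ : ℝ → G, IsOneParameterSubgroup X γ then h.choose 1 else 1

variable (E G) in
/-- The set `U_δ = exp (B_δ)`, where `B_δ` is the open ball of radius `δ` around `0` in the Lie
algebra `T_e G`, whose norm is that of the model space `E`. -/
def expBall (δ : ℝ) : Set G :=
  (fun X : GroupLieAlgebra 𝓘(ℝ, E) G => lieExp X) '' {X | ‖(show E from X)‖ < δ}

end LieGroupExp

/-- The word length `inf {m : g ∈ V ^ m}` of `g` with respect to `V`, where `V ^ 0 = {e}` and
`V ^ m` is the set of products of `m` elements of `V`; it is `⊤` if there is no such `m`. -/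
def wordLength {G : Type*} [Group G] (V : Set G) (g : G) : ℕ∞ :=
  ⨅ (m : ℕ) (_ : g ∈ V ^ m), (m : ℕ∞)

section Processes

variable {Ω : Type*} [MeasurableSpace Ω]

/-- An additive filtration `F s t`, `s ≤ t`, that satisfies the usual hypotheses.
The values `F s t` with `t < s` play no role. -/
structure IsAdditiveFiltration (P : Measure Ω) (F : ℝ≥0 → ℝ≥0 → MeasurableSpace Ω) : Prop where
  le : ∀ s t, s ≤ t → F s t ≤ ‹MeasurableSpace Ω›
  indep : ∀ s t u v, s ≤ t → t ≤ u → u ≤ v → Indep (F s t) (F u v) P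
  mono : ∀ s t u v, s ≤ t → t ≤ u → u ≤ v → F t u ≤ F s v
  right_continuous : ∀ s t, s ≤ t → ⨅ t' : Ioi t, F s t' = F s t
  complete : ∀ s t, s ≤ t → ∀ N : Set Ω, P N = 0 → MeasurableSet[F s t] N

variable {G : Type*} [TopologicalSpace G] [Group G]

/-- The two-parameter process `x s t`, `s ≤ t`, is multiplicative with respect to `F`.
The values `x s t` with `t < s` play no role. -/
structure IsMultiplicativeProcess [MeasurableSpace G] (P : Measure Ω)
    (F : ℝ≥0 → ℝ≥0 → MeasurableSpace Ω) (x : ℝ≥0 → ℝ≥0 → Ω → G) : Prop where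
  adapted : ∀ s t, s ≤ t → Measurable[F s t] (x s t)
  self_eq : ∀ s, ∀ᵐ ω ∂P, x s s ω = 1
  mul_eq : ∀ s t u, s ≤ t → t ≤ u → ∀ᵐ ω ∂P, x s t ω * x t u ω = x s u ω
  stochastically_continuous : ∀ s t, s ≤ t → ∀ U : Set G, IsOpen U → (1 : G) ∈ U →
    Tendsto (fun p : ℝ≥0 × ℝ≥0 => P {ω | (x s t ω)⁻¹ * x p.1 p.2 ω ∈ U})
      (𝓝[{p | p.1 ≤ p.2}] (s, t)) (𝓝 1)

/-- `f` is càdlàg on the interval `D`: right-continuous with left limits. -/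
def IsCadlagOn {S : Type*} [TopologicalSpace S] (f : ℝ≥0 → S) (D : Set ℝ≥0) : Prop :=
  ∀ t ∈ D, ContinuousWithinAt f (D ∩ Ioi t) t ∧ ∃ l, Tendsto f (𝓝[D ∩ Iio t] t) (𝓝 l)

/-- Almost every path `(s, t) ↦ x s t ω`, `s ≤ t`, is càdlàg in both arguments. -/
def HasCadlagPaths {S : Type*} [TopologicalSpace S] (P : Measure Ω)
    (x : ℝ≥0 → ℝ≥0 → Ω → S) : Prop :=
  ∀ᵐ ω ∂P, (∀ s, IsCadlagOn (fun t => x s t ω) (Ici s)) ∧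
    (∀ t, IsCadlagOn (fun s => x s t ω) (Iic t))

/-- The jumps of `x` are bounded in `A`: almost surely, for all `t` the jump
`lim_{s ↑ t} x s t` at time `t` lies in `A`. -/
def JumpsBoundedIn (P : Measure Ω) (x : ℝ≥0 → ℝ≥0 → Ω → G) (A : Set G) : Prop :=
  (1 : G) ∈ A ∧ ∀ᵐ ω ∂P, ∀ t, 0 < t → ∃ g ∈ A, Tendsto (fun s => x s t ω) (𝓝[<] t) (𝓝 g)

/-- The process `x` has bounded jumps: they are bounded in `(U_δ) ^ n` for some `δ > 0` and `n`. -/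
def HasBoundedJumps (E : Type*) [NormedAddCommGroup E] [NormedSpace ℝ E] [ChartedSpace E G]
    (P : Measure Ω) (x : ℝ≥0 → ℝ≥0 → Ω → G) : Prop :=
  ∃ δ : ℝ, 0 < δ ∧ ∃ n : ℕ, JumpsBoundedIn P x (expBall E G δ ^ n)

/-- `sup_{r < s < t < u} exp (α · inf {m : x s t ∈ V ^ m})`, with `exp ∞ = ∞`, `exp (-∞) = 0` and
`0 · ∞ = 0`. -/
def supExpWordLength (x : ℝ≥0 → ℝ≥0 → Ω → G) (V : Set G) (α : ℝ) (r u : ℝ≥0) (ω : Ω) : ℝ≥0∞ :=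
  ⨆ (s : ℝ≥0) (t : ℝ≥0) (_ : r < s ∧ s < t ∧ t < u),
    EReal.exp ((α : EReal) * ((wordLength V (x s t ω) : ℝ≥0∞) : EReal))

end Processes

end

/-!
The exponential moments come from counting exits of a discretized path, and the count is controlled
by independence and stochastic continuity alone; the bounded jumps enter only when word lengths are
compared with the count.

Let `V` be symmetric. Along a grid in `[0, T]`, restart the product of increments after each exit
from `V`, and let `N` be the number of exits. By stochastic continuity, uniform on `[0, T]`
(`IsMultiplicativeProcess.exists_forall_measure_notMem_le`), and Ottaviani's inequality
(`sum_measure_firstExit_le`), the probability of an exit within a time block of length `h` is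
arbitrarily small if `h` is, whatever the grid. If it is at most `1 / (2 b)`, the decomposition at
the first exit yields a bound for `E [b ^ N]` that depends only on `b` and the number of blocks
(`lintegral_exitWeight_le`).

An exit occurs at the product of an element of `V` and one grid increment. Almost surely, all
increments of a sufficiently fine grid lie in a fixed power of `V`
(`IsRightContinuousMulPath.exists_forall_mem_pow`): a Lebesgue number argument reduces this to the
left and right limits of the path at one time, hence to the jumps, and the jumps lie in a power of
`V` because `exp (B_δ)` does (`exists_expBall_subset_pow`). So the word lengths along a fine grid
are at most affine functions of `N`. Every increment is a limit from the right of grid increments,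
so that the supremum over all times is at most a constant times the lower limit of `b ^ N` along
finer and finer grids (`supExpWordLength_le_liminf`), and Fatou's lemma gives the finiteness.

For the measurability, a superlevel set of the supremum is a countable union of events that an
increment hits a closed set. A closed set may be hit at a single pair of times, so countably many
times do not suffice; such an event is the projection of a subset of `Ω × [0, ∞)²`, and it is
measurable by completeness and a capacitability argument (`nullMeasurableSet_proj`).
-/

/-! ### Measurable projections -/

/-- A set that can be approximated from inside, in outer measure, by measurable sets is
null-measurable. -/
lemma nullMeasurableSet_of_forall_lt_exists_subset {Ω : Type*} [MeasurableSpace Ω]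
    {P : Measure Ω} [IsFiniteMeasure P] {S : Set Ω}
    (h : ∀ c < P S, ∃ D ⊆ S, MeasurableSet D ∧ c ≤ P D) : NullMeasurableSet S P := by
  by_cases h0 : P S = 0
  · exact NullMeasurableSet.of_null h0
  have hlt : ∀ n : ℕ, P S - (n : ℝ≥0∞)⁻¹ < P S := fun n =>
    ENNReal.sub_lt_self (measure_ne_top P S) h0 (by simp)
  choose D hDS hDm hD using fun n => h _ (hlt n)
  have hsub : (⋃ n, D n) ⊆ S := iUnion_subset hDS
  have hle : P S ≤ P (⋃ n, D n) := by
    have ht : Tendsto (fun n : ℕ => P S - (n : ℝ≥0∞)⁻¹) atTop (𝓝 (P S - 0)) :=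
      ENNReal.Tendsto.sub tendsto_const_nhds ENNReal.tendsto_inv_nat_nhds_zero
        (Or.inl (measure_ne_top P S))
    rw [tsub_zero] at ht
    exact le_of_tendsto' ht fun n => (hD n).trans (measure_mono (subset_iUnion D n))
  have hae : (⋃ n, D n) =ᵐ[P] toMeasurable P S := by
    refine ae_eq_of_subset_of_measure_ge (hsub.trans (subset_toMeasurable P S)) ?_
      (MeasurableSet.iUnion hDm).nullMeasurableSet (measure_ne_top _ _)
    rwa [measure_toMeasurable]
  have hSae : S =ᵐ[P] (⋃ n, D n) := by
    refine (ae_le_set.2 ?_).antisymm hsub.eventuallyLE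
    exact measure_mono_null (sdiff_subset_sdiff_left (subset_toMeasurable P S))
      (ae_le_set.1 hae.symm.le)
  exact (MeasurableSet.iUnion hDm).nullMeasurableSet.congr hSae.symm

/-- Projection theorem for countable intersections of countable unions of rectangles with closed
sides in a compact set. Capacitability argument: the countable unions can be replaced by finite
ones, one after the other, at an arbitrarily small loss of outer measure; the set that remains has
a measurable projection, by compactness of its sections. -/
lemma nullMeasurableSet_proj {Ω : Type*} [MeasurableSpace Ω] {P : Measure Ω} [IsFiniteMeasure P]
    {T : Type*} [TopologicalSpace T] [T2Space T] {Q : Set T} (hQ : IsCompact Q)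
    (A : ℕ → ℕ → Set Ω) (hA : ∀ k j, MeasurableSet (A k j))
    (K : ℕ → ℕ → Set T) (hK : ∀ k j, IsClosed (K k j)) :
    NullMeasurableSet {ω | ∃ p ∈ Q, ∀ k, ∃ j, ω ∈ A k j ∧ p ∈ K k j} P := by
  apply nullMeasurableSet_of_forall_lt_exists_subset
  intro c hc
  set H0 : Set (Ω × T) := {z | z.2 ∈ Q ∧ ∀ k, ∃ j, z.1 ∈ A k j ∧ z.2 ∈ K k j} with hH0
  set B : ℕ → ℕ → Set (Ω × T) := fun k m => {z | ∃ j ≤ m, z.1 ∈ A k j ∧ z.2 ∈ K k j} with hB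
  -- The `k`-th union can be cut off at a finite index `m` so that the outer measure of the
  -- projection stays above `c`, by continuity of the outer measure along increasing sets.
  have hstep : ∀ (k : ℕ) (H : {H : Set (Ω × T) // H ⊆ H0 ∧ c < P (Prod.fst '' H)}),
      ∃ m, c < P (Prod.fst '' (H.1 ∩ B k m)) := by
    rintro k ⟨H, hH, hcH⟩
    have hmono : Monotone fun m => Prod.fst '' (H ∩ B k m) := by
      intro m m' hm
      refine image_mono (inter_subset_inter_right _ ?_)
      rintro z ⟨j, hj, hz⟩
      exact ⟨j, hj.trans hm, hz⟩
    have hU : (⋃ m, Prod.fst '' (H ∩ B k m)) = Prod.fst '' H := by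
      rw [← image_iUnion, ← inter_iUnion]
      congr 1
      refine inter_eq_left.2 fun z hz => ?_
      obtain ⟨j, hj⟩ := (hH hz).2 k
      exact mem_iUnion.2 ⟨j, j, le_rfl, hj⟩
    rw [← hU, hmono.measure_iUnion] at hcH
    exact lt_iSup_iff.1 hcH
  choose f hf using hstep
  have hH0c : c < P (Prod.fst '' H0) := by
    convert hc using 2
    ext ω
    simp [hH0]
  let Hs : ℕ → {H : Set (Ω × T) // H ⊆ H0 ∧ c < P (Prod.fst '' H)} := fun n =>
    Nat.rec ⟨H0, subset_rfl, hH0c⟩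
      (fun k H => ⟨H.1 ∩ B k (f k H), inter_subset_left.trans H.2.1, hf k H⟩) n
  set m : ℕ → ℕ := fun k => f k (Hs k) with hm
  have hHs : ∀ n, ∀ i < n, (Hs n).1 ⊆ B i (m i) := by
    intro n
    induction n with
    | zero => intro i hi; omega
    | succ n ih =>
      intro i hi
      rcases Nat.lt_succ_iff_lt_or_eq.1 hi with h | h
      · exact inter_subset_left.trans (ih i h)
      · subst h; exact inter_subset_right
  -- `D n` takes only the first `n` cut-off unions into account; it is measurable and has measure
  -- at least `c`, as it contains the projection of `Hs n`.
  set D : ℕ → Set Ω := fun n => {ω | ∃ p ∈ Q, ∀ i < n, (ω, p) ∈ B i (m i)} with hD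
  have hDm : ∀ n, MeasurableSet (D n) := by
    intro n
    have hDn : D n = ⋃ g : Fin n → ℕ,
        {_ω | (∀ i, g i ≤ m i) ∧ ∃ p ∈ Q, ∀ i : Fin n, p ∈ K i (g i)} ∩
          ⋂ i : Fin n, A i (g i) := by
      ext ω
      simp only [hD, hB, mem_ofPred_eq, mem_iUnion, mem_inter_iff, mem_iInter]
      constructor
      · rintro ⟨p, hp, h⟩
        choose g hg using fun i : Fin n => h i i.2
        exact ⟨g, ⟨fun i => (hg i).1, p, hp, fun i => (hg i).2.2⟩, fun i => (hg i).2.1⟩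
      · rintro ⟨g, ⟨h1, p, hp, h2⟩, h3⟩
        exact ⟨p, hp, fun i hi => ⟨g ⟨i, hi⟩, h1 ⟨i, hi⟩, h3 ⟨i, hi⟩, h2 ⟨i, hi⟩⟩⟩
    rw [hDn]
    exact MeasurableSet.iUnion fun g =>
      (MeasurableSet.const _).inter (MeasurableSet.iInter fun i => hA _ _)
  have hDanti : Antitone D := by
    rintro n n' hn ω ⟨p, hp, h⟩
    exact ⟨p, hp, fun i hi => h i (hi.trans_le hn)⟩
  refine ⟨⋂ n, D n, ?_, MeasurableSet.iInter hDm, ?_⟩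
  · intro ω hω
    have hω' : ∀ n, ω ∈ D n := mem_iInter.1 hω
    have hcl : ∀ i, IsClosed {p | (ω, p) ∈ B i (m i)} := by
      intro i
      have : {p | (ω, p) ∈ B i (m i)} = ⋃ j ∈ {j | j ≤ m i ∧ ω ∈ A i j}, K i j := by
        ext p
        simp [hB, and_assoc]
      rw [this]
      exact ((finite_Iic (m i)).subset fun j hj => hj.1).isClosed_biUnion fun j _ => hK i j
    have hcl' : ∀ n, IsClosed {p | p ∈ Q ∧ ∀ i < n, (ω, p) ∈ B i (m i)} := by
      intro n
      have : {p | p ∈ Q ∧ ∀ i < n, (ω, p) ∈ B i (m i)} =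
          Q ∩ ⋂ (i) (_ : i < n), {p | (ω, p) ∈ B i (m i)} := by
        ext p
        simp
      rw [this]
      exact hQ.isClosed.inter (isClosed_iInter fun i => isClosed_iInter fun _ => hcl i)
    obtain ⟨p, hp⟩ := IsCompact.nonempty_iInter_of_sequence_nonempty_isCompact_isClosed
      (fun n => {p | p ∈ Q ∧ ∀ i < n, (ω, p) ∈ B i (m i)})
      (fun n p hp => ⟨hp.1, fun i hi => hp.2 i (hi.trans n.lt_succ_self)⟩) (fun n => hω' n)
      (hQ.of_isClosed_subset (hcl' 0) fun p hp => hp.1) hcl'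
    rw [mem_iInter] at hp
    refine ⟨p, (hp 0).1, fun k => ?_⟩
    obtain ⟨j, -, hj⟩ := (hp (k + 1)).2 k k.lt_succ_self
    exact ⟨j, hj⟩
  · refine ge_of_tendsto' (tendsto_measure_iInter_atTop (fun n => (hDm n).nullMeasurableSet)
      hDanti ⟨0, measure_ne_top _ _⟩) fun n => ?_
    refine (Hs n).2.2.le.trans (measure_mono ?_)
    rintro _ ⟨z, hz, rfl⟩
    exact ⟨z.2, ((Hs n).2.1 hz).1, fun i hi => hHs n i hi hz⟩

/-! ### The exponential map and word lengths -/

section LieGroup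

variable {E : Type*} [NormedAddCommGroup E] [NormedSpace ℝ E]
  {G : Type*} [TopologicalSpace G] [ChartedSpace E G] [Group G]

lemma IsOneParameterSubgroup.map_zero {X : GroupLieAlgebra 𝓘(ℝ, E) G} {γ : ℝ → G}
    (h : IsOneParameterSubgroup X γ) : γ 0 = 1 := by
  simpa using h.map_add 0 0

/-- In the chart at `1`, the velocity at time `0` is an ordinary derivative. -/
lemma IsOneParameterSubgroup.hasDerivAt_chart {X : GroupLieAlgebra 𝓘(ℝ, E) G} {γ : ℝ → G}
    (h : IsOneParameterSubgroup X γ) :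
    HasDerivAt (fun t => extChartAt 𝓘(ℝ, E) (1 : G) (γ t)) (show E from X) 0 := by
  have hd : MDifferentiableAt 𝓘(ℝ, ℝ) 𝓘(ℝ, E) γ 0 := h.smooth.mdifferentiable (by simp) 0
  have h1 := hd.hasMFDerivAt.2
  have h0 := h.map_zero
  have hv := h.velocity
  simp only [writtenInExtChartAt, extChartAt_model_space_eq_id, h0] at h1
  simp only [mfld_simps] at h1
  have h1' : HasFDerivAt (fun t => extChartAt 𝓘(ℝ, E) (1 : G) (γ t))
      (show ℝ →L[ℝ] E from mfderiv 𝓘(ℝ, ℝ) 𝓘(ℝ, E) γ 0) 0 := hasFDerivWithinAt_univ.1 h1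
  have h2 := h1'.hasDerivAt
  have hv' : (mfderiv 𝓘(ℝ, ℝ) 𝓘(ℝ, E) γ 0 (1 : ℝ) : E) = (show E from X) := hv
  rw [← hv']
  exact h2

variable [LieGroup 𝓘(ℝ, E) (⊤ : ℕ∞) G]

/-- In the chart at `1`, multiplication is Lipschitz in the second factor near `(1, 1)`. -/
lemma exists_lipschitz_mul_chart : ∃ (K : ℝ≥0) (O : Set G), O ∈ 𝓝 (1 : G) ∧
    ∀ g ∈ O, ∀ h ∈ O,
      ‖extChartAt 𝓘(ℝ, E) (1 : G) (g * h) - extChartAt 𝓘(ℝ, E) (1 : G) g‖ ≤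
        K * ‖extChartAt 𝓘(ℝ, E) (1 : G) h - extChartAt 𝓘(ℝ, E) (1 : G) 1‖ := by
  set φ := extChartAt 𝓘(ℝ, E) (1 : G) with hφ
  have hsymm : ContMDiffAt 𝓘(ℝ, E) 𝓘(ℝ, E) 1 φ.symm (φ 1) := by
    have := contMDiffOn_extChartAt_symm (I := 𝓘(ℝ, E)) (n := 1) (1 : G)
    exact (this (φ 1) (mem_extChartAt_target _)).contMDiffAt (extChartAt_target_mem_nhds _)
  have hmul : ContMDiff (𝓘(ℝ, E).prod 𝓘(ℝ, E)) 𝓘(ℝ, E) 1 (fun p : G × G => p.1 * p.2) :=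
    (contMDiff_mul 𝓘(ℝ, E) (⊤ : ℕ∞) (G := G)).of_le (by exact_mod_cast le_top)
  have h1 : φ.symm (φ 1) = 1 := extChartAt_to_inv _
  have hφc : ContMDiffAt 𝓘(ℝ, E) 𝓘(ℝ, E) 1 φ (1 : G) := contMDiffAt_extChartAt
  have hm : ContMDiffAt 𝓘(ℝ, E × E) 𝓘(ℝ, E) 1
      (fun p : E × E => φ (φ.symm p.1 * φ.symm p.2)) (φ 1, φ 1) := by
    have ha : ContMDiffAt 𝓘(ℝ, E × E) 𝓘(ℝ, E) 1 (fun p : E × E => φ.symm p.1) (φ 1, φ 1) :=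
      ContMDiffAt.comp (φ 1, φ 1) hsymm contDiffAt_fst.contMDiffAt
    have hb : ContMDiffAt 𝓘(ℝ, E × E) 𝓘(ℝ, E) 1 (fun p : E × E => φ.symm p.2) (φ 1, φ 1) :=
      ContMDiffAt.comp (φ 1, φ 1) hsymm contDiffAt_snd.contMDiffAt
    have hab : ContMDiffAt 𝓘(ℝ, E × E) 𝓘(ℝ, E) 1
        (fun p : E × E => φ.symm p.1 * φ.symm p.2) (φ 1, φ 1) :=
      ContMDiffAt.comp (φ 1, φ 1) hmul.contMDiffAt (ha.prodMk hb)
    refine ContMDiffAt.comp (φ 1, φ 1) ?_ hab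
    simpa [h1] using hφc
  obtain ⟨K, s, hs, hK⟩ := hm.contDiffAt.exists_lipschitzOnWith
  rw [nhds_prod_eq] at hs
  obtain ⟨s₁, hs₁, s₂, hs₂, hs12⟩ := Filter.mem_prod_iff.1 hs
  have hcont : ContinuousAt φ (1 : G) := continuousAt_extChartAt _
  refine ⟨K, φ.source ∩ φ ⁻¹' (s₁ ∩ s₂), inter_mem (extChartAt_source_mem_nhds _)
    (hcont (inter_mem hs₁ hs₂)), ?_⟩
  rintro g ⟨hg, hgs⟩ h ⟨hh, hhs⟩
  have := hK.norm_sub_le (x := (φ g, φ h)) (hs12 ⟨hgs.1, hhs.2⟩) (y := (φ g, φ 1))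
    (hs12 ⟨hgs.1, mem_of_mem_nhds hs₂⟩)
  simpa [φ.left_inv hg, φ.left_inv hh, h1] using this

/-- There is a radius `ρ`, depending only on `V`, such that a one-parameter subgroup of speed `v`
stays in `V` for times `T` with `T * v < ρ`. No differential equation is solved: `γ T` is
written as the power `γ (T / N) ^ N`, and by the Lipschitz bound on multiplication the `N`
increments in the chart are at most a constant times `T * v / N`. -/
lemma exists_oneParameter_mem_of_mem_nhds {V : Set G} (hV : V ∈ 𝓝 (1 : G)) :
    ∃ ρ : ℝ, 0 < ρ ∧ ∀ (γ : ℝ → G) (X : E), (∀ a b, γ (a + b) = γ a * γ b) → ContinuousAt γ 0 →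
      HasDerivAt (fun t => extChartAt 𝓘(ℝ, E) (1 : G) (γ t)) X 0 →
      ∀ T : ℝ, 0 < T → T * ‖X‖ < ρ → γ T ∈ V := by
  have := topologicalGroup_of_lieGroup 𝓘(ℝ, E) (⊤ : ℕ∞) (G := G)
  obtain ⟨K, O, hO, hK⟩ := exists_lipschitz_mul_chart (E := E) (G := G)
  set φ := extChartAt 𝓘(ℝ, E) (1 : G) with hφ
  -- `W` is stable under multiplication up to `φ.source`, where the chart determines the point.
  obtain ⟨W, hW, hWO, hWsrc⟩ : ∃ W ∈ 𝓝 (1 : G), W ⊆ O ∩ V ∧ ∀ g ∈ W, ∀ h ∈ W, g * h ∈ φ.source := by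
    have hsrc : φ.source ∈ 𝓝 ((1 : G) * 1) := by
      rw [mul_one]; exact extChartAt_source_mem_nhds _
    have := (continuous_mul (M := G)).continuousAt (x := ((1 : G), (1 : G))) hsrc
    rw [nhds_prod_eq] at this
    obtain ⟨s₁, hs₁, s₂, hs₂, hs12⟩ := Filter.mem_prod_iff.1 this
    refine ⟨s₁ ∩ s₂ ∩ (O ∩ V), inter_mem (inter_mem hs₁ hs₂) (inter_mem hO hV),
      inter_subset_right, fun g hg h hh => ?_⟩
    exact hs12 (show (g, h) ∈ s₁ ×ˢ s₂ from ⟨hg.1.1, hh.1.2⟩)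
  obtain ⟨ρ, hρ, hball⟩ : ∃ ρ > 0, ∀ g ∈ φ.source, ‖φ g - φ 1‖ < ρ → g ∈ W := by
    have hsy : ContinuousAt φ.symm (φ 1) := continuousAt_extChartAt_symm _
    have hW' : W ∈ 𝓝 (φ.symm (φ 1)) := by rwa [hφ, extChartAt_to_inv]
    obtain ⟨ρ, hρ, h⟩ := Metric.mem_nhds_iff.1 (hsy hW')
    refine ⟨ρ, hρ, fun g hg hgρ => ?_⟩
    have : φ g ∈ Metric.ball (φ 1) ρ := by rwa [mem_ball_iff_norm]
    simpa [φ.left_inv hg] using h this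
  refine ⟨ρ / (K + 1), by positivity, fun γ X hγ hγc hγd T hT hTX => ?_⟩
  have hγ0 : γ 0 = 1 := by simpa using hγ 0 0
  have hpow : ∀ (s : ℝ) (k : ℕ), γ (k * s) = γ s ^ k := by
    intro s k
    induction k with
    | zero => simpa using hγ0
    | succ k ih => rw [pow_succ, ← ih, ← hγ]; congr 1; push_cast; ring
  have hTX' : K * (T * ‖X‖) < ρ := by
    rw [lt_div_iff₀ (by positivity)] at hTX
    nlinarith [mul_nonneg hT.le (norm_nonneg X)]
  have hTn : Tendsto (fun N : ℕ => T / (N : ℝ)) atTop (𝓝 0) := tendsto_const_div_atTop_nhds_zero_nat T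
  have hlim : Tendsto (fun N : ℕ => K * (N * ‖φ (γ (T / N)) - φ 1‖)) atTop (𝓝 (K * (T * ‖X‖))) := by
    refine Tendsto.const_mul _ ?_
    have hne : Tendsto (fun N : ℕ => T / (N : ℝ)) atTop (𝓝[≠] 0) := by
      refine tendsto_nhdsWithin_iff.2 ⟨hTn, ?_⟩
      filter_upwards [eventually_gt_atTop 0] with N hN
      have : (0 : ℝ) < N := by exact_mod_cast hN
      exact (by positivity : T / N ≠ 0)
    have h1 := (((hasDerivAt_iff_tendsto_slope.1 hγd).comp hne).norm).const_mul T
    refine h1.congr' ?_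
    filter_upwards [eventually_gt_atTop 0] with N hN
    have hN' : (0 : ℝ) < N := by exact_mod_cast hN
    simp only [Function.comp, slope_def_module, hγ0, sub_zero, norm_smul, norm_inv, norm_div,
      Real.norm_of_nonneg hT.le, Real.norm_of_nonneg hN'.le]
    field_simp
  have hγW : ∀ᶠ N : ℕ in atTop, γ (T / N) ∈ W := by
    have : Tendsto γ (𝓝 0) (𝓝 1) := by simpa [ContinuousAt, hγ0] using hγc
    exact (this.comp hTn) hW
  obtain ⟨N, hNlt, hNW, hN⟩ :=
    ((hlim.eventually_lt_const hTX').and (hγW.and (eventually_gt_atTop 0))).exists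
  have hN' : (0 : ℝ) < N := by exact_mod_cast hN
  set a := γ (T / N) with ha
  have key : ∀ k ≤ N, a ^ k ∈ W ∧ ‖φ (a ^ k) - φ 1‖ ≤ k * (K * ‖φ a - φ 1‖) := by
    intro k
    induction k with
    | zero => intro _; simpa using mem_of_mem_nhds hW
    | succ k ih =>
      intro hk
      obtain ⟨hkW, hkn⟩ := ih (by omega)
      have hle : ‖φ (a ^ (k + 1)) - φ 1‖ ≤ (k + 1 : ℕ) * (K * ‖φ a - φ 1‖) := by
        have h1 := hK _ (hWO hkW).1 _ (hWO hNW).1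
        rw [← pow_succ] at h1
        calc ‖φ (a ^ (k + 1)) - φ 1‖
            = ‖(φ (a ^ (k + 1)) - φ (a ^ k)) + (φ (a ^ k) - φ 1)‖ := by congr 1; abel
          _ ≤ _ := (norm_add_le _ _).trans (add_le_add h1 hkn)
          _ = _ := by push_cast; ring
      refine ⟨hball _ ?_ (hle.trans_lt (lt_of_le_of_lt ?_ hNlt)), hle⟩
      · rw [pow_succ]; exact hWsrc _ hkW _ hNW
      · have : ((k + 1 : ℕ) : ℝ) ≤ N := by exact_mod_cast hk
        calc ((k + 1 : ℕ) : ℝ) * (K * ‖φ a - φ 1‖) ≤ N * (K * ‖φ a - φ 1‖) := by gcongr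
          _ = _ := by ring
  have hfin := (hWO (key N le_rfl).1).2
  rw [ha, ← hpow] at hfin
  convert hfin using 2
  field_simp

/-- The set `exp (B_δ)` consists of words of bounded length in any neighbourhood of `1`: for large
`q`, `exp X = exp (X / q) ^ q` with `exp (X / q)` close to `1`. -/
lemma exists_expBall_subset_pow (δ : ℝ) {V : Set G} (hV : V ∈ 𝓝 (1 : G)) :
    ∃ c : ℕ, expBall E G δ ⊆ V ^ c := by
  obtain ⟨ρ, hρ, h⟩ := exists_oneParameter_mem_of_mem_nhds (E := E) hV
  obtain ⟨q, hq⟩ := exists_nat_gt (max (δ / ρ) 0)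
  have hq0 : (0 : ℝ) < q := (le_max_right _ _).trans_lt hq
  have hqδ : δ / ρ < q := (le_max_left _ _).trans_lt hq
  refine ⟨q, ?_⟩
  rintro _ ⟨X, hX, rfl⟩
  have h1V : (1 : G) ∈ V := mem_of_mem_nhds hV
  simp only [lieExp]
  split_ifs with hex
  · have hγ := hex.choose_spec
    set γ := hex.choose
    have hmem : γ (1 / q) ∈ V := by
      refine h γ (show E from X) hγ.map_add hγ.smooth.continuous.continuousAt hγ.hasDerivAt_chart _
        (by positivity) ?_
      have hX' : ‖(show E from X)‖ < δ := hX
      rw [div_lt_iff₀ hρ] at hqδ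
      rw [one_div, inv_mul_lt_iff₀ hq0]
      exact hX'.trans hqδ
    have hpow : ∀ k : ℕ, γ (k * (1 / q)) = γ (1 / q) ^ k := by
      intro k
      induction k with
      | zero => simpa using hγ.map_zero
      | succ k ih => rw [pow_succ, ← ih, ← hγ.map_add]; congr 1; push_cast; ring
    have := hpow q
    rw [mul_one_div_cancel hq0.ne'] at this
    rw [this]
    exact Set.pow_mem_pow hmem
  -- the default value `1` of `lieExp`
  · simpa using Set.pow_mem_pow (n := q) h1V

end LieGroup

/-! ### Exit counts of products of independent factors -/

section Exits

variable {Ω G : Type*}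

/-- The event that `j` is the first index after `i` at which `S i j`, the product of the factors
with indices `i + 1, …, j`, is outside `U`. -/
def firstExit (S : ℕ → ℕ → Ω → G) (U : Set G) (i j : ℕ) : Set Ω :=
  {ω | S i j ω ∉ U ∧ ∀ k, i < k → k < j → S i k ω ∈ U}

/-- A weight that is at least `b ^ N`, where `N` is the number of exits from `U` in `(i, L]` when
the product is restarted after each exit. The first argument bounds the number of exits that are
counted; the summand `1` accounts for the paths without exit. -/
noncomputable def exitWeight (S : ℕ → ℕ → Ω → G) (U : Set G) (b : ℝ≥0∞) (L : ℕ) : ℕ → ℕ → Ω → ℝ≥0∞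
  | 0, _, _ => 1
  | n + 1, i, ω => 1 + ∑ j ∈ Finset.Ioc i L,
      (firstExit S U i j).indicator (fun ω => b * exitWeight S U b L n j ω) ω

lemma one_le_exitWeight (S : ℕ → ℕ → Ω → G) (U : Set G) (b : ℝ≥0∞) (L n i : ℕ) (ω : Ω) :
    1 ≤ exitWeight S U b L n i ω := by
  cases n with
  | zero => simp [exitWeight]
  | succ n => simp [exitWeight]

lemma le_exitWeight_succ {S : ℕ → ℕ → Ω → G} {U : Set G} (b : ℝ≥0∞) {L i j : ℕ} (n : ℕ)
    (hij : i < j) (hjL : j ≤ L) {ω : Ω} (hω : ω ∈ firstExit S U i j) :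
    b * exitWeight S U b L n j ω ≤ exitWeight S U b L (n + 1) i ω := by
  rw [exitWeight]
  refine le_trans ?_ le_add_self
  refine le_trans ?_ (Finset.single_le_sum
    (f := fun j => (firstExit S U i j).indicator (fun ω => b * exitWeight S U b L n j ω) ω)
    (fun _ _ => zero_le) (Finset.mem_Ioc.2 ⟨hij, hjL⟩))
  simp [indicator_of_mem hω]

lemma pairwise_disjoint_firstExit (S : ℕ → ℕ → Ω → G) (U : Set G) (i : ℕ) (s : Finset ℕ)
    (hs : ∀ j ∈ s, i < j) : (s : Set ℕ).PairwiseDisjoint (firstExit S U i) := by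
  have key : ∀ j ∈ s, ∀ k, j < k → Disjoint (firstExit S U i j) (firstExit S U i k) :=
    fun j hj k hjk => Set.disjoint_left.2 fun ω h1 h2 => h1.1 (h2.2 j (hs j hj) hjk)
  intro j hj k hk hjk
  rcases lt_or_gt_of_ne hjk with h | h
  · exact key j hj k h
  · exact (key k hk j h).symm

/-- A product is a word of length `k * (c + 1) + 1` if all single factors have length at most `c`,
and the exit weight is at least `b ^ k` for such a `k`: every exit occurs at a product of an
element of `U` and a single factor. -/
lemma exists_mem_pow_le_exitWeight [Group G] {S : ℕ → ℕ → Ω → G} {U V : Set G} (hUV : U ⊆ V)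
    (h1 : (1 : G) ∈ U) (b : ℝ≥0∞) {L c : ℕ} {ω : Ω} (hself : ∀ i ≤ L, S i i ω = 1)
    (hmul : ∀ i j k, i ≤ j → j ≤ k → k ≤ L → S i j ω * S j k ω = S i k ω)
    (hstep : ∀ i < L, S i (i + 1) ω ∈ V ^ c) (n i j : ℕ) (hij : i ≤ j) (hjL : j ≤ L)
    (hn : j ≤ i + n) :
    ∃ k : ℕ, S i j ω ∈ V ^ (k * (c + 1) + 1) ∧ b ^ k ≤ exitWeight S U b L n i ω := by
  induction n generalizing i with
  | zero =>
    obtain rfl : i = j := by omega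
    exact ⟨0, by simpa [hself i hjL] using hUV h1, by simp [exitWeight]⟩
  | succ n ih =>
    by_cases hex : ∃ l, i < l ∧ l ≤ j ∧ S i l ω ∉ U
    · classical
      obtain ⟨hil, hlj, hlU⟩ := Nat.find_spec hex
      set l := Nat.find hex
      have hfirst : ∀ k, i < k → k < l → S i k ω ∈ U := fun k hik hkl => by
        by_contra hk
        exact Nat.find_min hex hkl ⟨hik, (hkl.trans_le hlj).le, hk⟩
      obtain ⟨k, hkS, hkw⟩ := ih l hlj (by omega)
      refine ⟨k + 1, ?_, ?_⟩
      · have hprev : S i (l - 1) ω ∈ V := by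
          rcases Nat.lt_or_ge i (l - 1) with h | h
          · exact hUV (hfirst _ h (by omega))
          · have : l - 1 = i := by omega
            rw [this, hself i (by omega)]
            exact hUV h1
        have hs := hstep (l - 1) (by omega)
        have e1 := hmul i (l - 1) l (by omega) (by omega) (by omega)
        have e2 := hmul i l j hil.le hlj hjL
        rw [show l - 1 + 1 = l by omega] at hs
        have e3 : V ^ ((k + 1) * (c + 1) + 1) = V * V ^ c * V ^ (k * (c + 1) + 1) := by
          rw [← pow_succ', ← pow_add]; congr 1; ring
        rw [← e2, ← e1, e3]
        exact Set.mul_mem_mul (Set.mul_mem_mul hprev hs) hkS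
      · rw [pow_succ']
        exact (mul_le_mul_right hkw b).trans
          (le_exitWeight_succ b n hil (hlj.trans hjL) ⟨hlU, hfirst⟩)
    · push Not at hex
      refine ⟨0, ?_, by simpa using one_le_exitWeight S U b L (n + 1) i ω⟩
      rcases hij.eq_or_lt with rfl | h
      · simpa [hself i hjL] using hUV h1
      · simpa using hUV (hex j h le_rfl)

/-- Bounds for the expected exit weight, indexed by the number of remaining blocks. -/
noncomputable def exitBound (b : ℝ≥0∞) : ℕ → ℝ≥0∞
  | 0 => 2
  | k + 1 => 2 * (1 + b * exitBound b k)

lemma exitBound_ne_top {b : ℝ≥0∞} (hb : b ≠ ∞) (k : ℕ) : exitBound b k ≠ ∞ := by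
  induction k with
  | zero => simp [exitBound]
  | succ k ih =>
    rw [exitBound]
    exact ENNReal.mul_ne_top (by simp) (ENNReal.add_ne_top.2 ⟨by simp, ENNReal.mul_ne_top hb ih⟩)

lemma exitBound_mono {b : ℝ≥0∞} (hb : 1 ≤ b) : Monotone (exitBound b) := by
  refine monotone_nat_of_le_succ fun k => ?_
  rw [exitBound]
  calc exitBound b k ≤ b * exitBound b k := le_mul_of_one_le_left zero_le hb
    _ ≤ 1 + b * exitBound b k := le_add_self
    _ ≤ _ := le_mul_of_one_le_left zero_le (by norm_num)

/-- The recursion behind `exitBound`: in a block in which the exit probability is at most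
`1 / (2 b)`, the block's own contribution is absorbed by the left-hand side. -/
lemma one_add_le_exitBound {b p : ℝ≥0∞} (hp : b * p ≤ 1 / 2) (k : ℕ) :
    1 + b * (p * exitBound b k + if k = 0 then 0 else exitBound b (k - 1)) ≤ exitBound b k := by
  have h2 : b * (p * exitBound b k) ≤ exitBound b k / 2 := by
    rw [← mul_assoc]
    refine (mul_le_mul_left hp _).trans_eq ?_
    rw [one_div, mul_comm, ENNReal.div_eq_inv_mul, mul_comm]
  have h3 : 1 + b * (if k = 0 then 0 else exitBound b (k - 1)) = exitBound b k / 2 := by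
    cases k with
    | zero => simp [exitBound, ENNReal.div_self]
    | succ k =>
      simp only [exitBound, Nat.add_eq_zero_iff, one_ne_zero, and_false, if_false,
        Nat.add_sub_cancel]
      rw [div_eq_mul_inv, mul_comm 2, mul_assoc, ENNReal.mul_inv_cancel (by simp) (by simp), mul_one]
  rw [mul_add, add_left_comm, h3]
  calc _ ≤ exitBound b k / 2 + exitBound b k / 2 := by gcongr
    _ = _ := ENNReal.add_halves _

lemma measurableSet_firstExit [MeasurableSpace G] {S : ℕ → ℕ → Ω → G} {U : Set G}
    {ℱ : ℕ → ℕ → MeasurableSpace Ω}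
    (hmono : ∀ i j k l, i ≤ j → j ≤ k → k ≤ l → ℱ j k ≤ ℱ i l)
    (hS : ∀ i j, i ≤ j → Measurable[ℱ i j] (S i j)) (hUm : MeasurableSet U) {i j : ℕ}
    (hij : i ≤ j) : MeasurableSet[ℱ i j] (firstExit S U i j) := by
  have : firstExit S U i j =
      (S i j ⁻¹' Uᶜ) ∩ ⋂ (k) (_ : i < k) (_ : k < j), S i k ⁻¹' U := by
    ext ω
    simp [firstExit]
  rw [this]
  refine MeasurableSet.inter (hS i j hij hUm.compl) ?_
  refine MeasurableSet.iInter fun k => MeasurableSet.iInter fun hik =>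
    MeasurableSet.iInter fun hkj => ?_
  exact hmono i i k j le_rfl hik.le hkj.le _ (hS i k hik.le hUm)

lemma measurable_exitWeight {S : ℕ → ℕ → Ω → G} {U : Set G} {b : ℝ≥0∞} {L : ℕ}
    {ℱ : ℕ → ℕ → MeasurableSpace Ω}
    (hmono : ∀ i j k l, i ≤ j → j ≤ k → k ≤ l → ℱ j k ≤ ℱ i l)
    (hE : ∀ i j, i ≤ j → MeasurableSet[ℱ i j] (firstExit S U i j)) (n i : ℕ) (hi : i ≤ L) :
    Measurable[ℱ i L] (exitWeight S U b L n i) := by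
  induction n generalizing i with
  | zero => exact measurable_const
  | succ n ih =>
    have : exitWeight S U b L (n + 1) i = fun ω => 1 + ∑ j ∈ Finset.Ioc i L,
      (firstExit S U i j).indicator (fun ω => b * exitWeight S U b L n j ω) ω := rfl
    rw [this]
    refine Measurable.const_add (Finset.measurable_fun_sum _ fun j hj => ?_) _
    obtain ⟨hij, hjL⟩ := Finset.mem_Ioc.1 hj
    refine Measurable.indicator (Measurable.const_mul ?_ b) (hmono i i j L le_rfl hij.le hjL _
      (hE i j hij.le))
    exact (ih j hjL).mono (hmono i j L L hij.le hjL le_rfl) le_rfl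

variable [MeasurableSpace Ω] {P : Measure Ω}

/-- Ottaviani's inequality for the probability of an exit from `U` in `(i, m]`: if the increments
up to `m` leave `W` with probability at most `η`, and `W / W ⊆ U`, then an exit has probability
at most `2 η`. -/
lemma sum_measure_firstExit_le [IsProbabilityMeasure P] [Group G] [MeasurableSpace G]
    {S : ℕ → ℕ → Ω → G}
    {ℱ : ℕ → ℕ → MeasurableSpace Ω} (hℱ : ∀ i j, i ≤ j → ℱ i j ≤ ‹MeasurableSpace Ω›)
    (hind : ∀ i j k, i ≤ j → j ≤ k → Indep (ℱ i j) (ℱ j k) P)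
    (hS : ∀ i j, i ≤ j → Measurable[ℱ i j] (S i j))
    {U W : Set G} (hWm : MeasurableSet W) (hWU : ∀ v ∈ W, ∀ w ∈ W, v * w⁻¹ ∈ U)
    (hE : ∀ i j, i ≤ j → MeasurableSet[ℱ i j] (firstExit S U i j))
    {i m : ℕ} {η : ℝ≥0∞}
    (hmul : ∀ j, i ≤ j → j ≤ m → ∀ᵐ ω ∂P, S i j ω * S j m ω = S i m ω)
    (hη : ∀ j, i ≤ j → j ≤ m → P {ω | S j m ω ∉ W} ≤ η) :
    ∑ j ∈ Finset.Ioc i m, P (firstExit S U i j) ≤ 2 * η := by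
  rcases Nat.lt_or_ge m i with him | him
  · simp [Finset.Ioc_eq_empty (by omega : ¬ i < m)]
  set B : ℕ → Set Ω := fun j => {ω | S j m ω ∉ W} with hB
  have hBm : ∀ j, j ≤ m → MeasurableSet[ℱ j m] (B j) := fun j hj => hS j m hj hWm.compl
  have hEm : ∀ j ∈ Finset.Ioc i m, MeasurableSet (firstExit S U i j) := fun j hj =>
    hℱ i j (Finset.mem_Ioc.1 hj).1.le _ (hE i j (Finset.mem_Ioc.1 hj).1.le)
  have hd := pairwise_disjoint_firstExit S U i (Finset.Ioc i m)
    fun j hj => (Finset.mem_Ioc.1 hj).1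
  have hsplit : ∀ j ∈ Finset.Ioc i m, P (firstExit S U i j) ≤
      P (firstExit S U i j ∩ B i) + P (firstExit S U i j) * η := by
    intro j hj
    obtain ⟨hij, hjm⟩ := Finset.mem_Ioc.1 hj
    have hle : P (firstExit S U i j) ≤
        P ((firstExit S U i j ∩ B i) ∪ (firstExit S U i j ∩ B j)) := by
      refine measure_mono_ae ?_
      filter_upwards [hmul j hij.le hjm] with ω hω hωE
      by_cases h1 : ω ∈ B i
      · exact Or.inl ⟨hωE, h1⟩
      by_cases h2 : ω ∈ B j
      · exact Or.inr ⟨hωE, h2⟩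
      refine absurd ?_ hωE.1
      have := hWU _ (not_not.1 h1) _ (not_not.1 h2)
      rwa [← hω, mul_inv_cancel_right] at this
    refine hle.trans ((measure_union_le _ _).trans (add_le_add_right ?_ _))
    rw [(Indep_iff _ _ _).1 (hind i j m hij.le hjm) _ _ (hE i j hij.le) (hBm j hjm)]
    exact mul_le_mul_right (hη j hij.le hjm) _
  have hsum1 : ∑ j ∈ Finset.Ioc i m, P (firstExit S U i j) ≤ 1 := by
    rw [← measure_biUnion_finset hd hEm]
    exact prob_le_one
  calc ∑ j ∈ Finset.Ioc i m, P (firstExit S U i j)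
      ≤ ∑ j ∈ Finset.Ioc i m, (P (firstExit S U i j ∩ B i) + P (firstExit S U i j) * η) :=
        Finset.sum_le_sum hsplit
    _ = P (⋃ j ∈ Finset.Ioc i m, firstExit S U i j ∩ B i)
          + (∑ j ∈ Finset.Ioc i m, P (firstExit S U i j)) * η := by
        rw [Finset.sum_add_distrib, Finset.sum_mul, measure_biUnion_finset]
        · exact hd.mono fun j => inter_subset_left
        · exact fun j hj => (hEm j hj).inter (hℱ i m him _ (hBm i him))
    _ ≤ η + 1 * η := by
        gcongr
        exact (measure_mono (iUnion₂_subset fun j _ => inter_subset_right)).trans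
          (hη i le_rfl him)
    _ = 2 * η := by ring

/-- The expected exit weight is bounded in terms of the number of blocks alone. Here `κ` is the
number of blocks that remain, a block being a maximal set of indices on which `κ` is constant, and
increments within a block leave `W` with probability at most `η`. -/
lemma lintegral_exitWeight_le [IsProbabilityMeasure P] [Group G] [MeasurableSpace G]
    {S : ℕ → ℕ → Ω → G}
    {ℱ : ℕ → ℕ → MeasurableSpace Ω} (hℱ : ∀ i j, i ≤ j → ℱ i j ≤ ‹MeasurableSpace Ω›)
    (hmono : ∀ i j k l, i ≤ j → j ≤ k → k ≤ l → ℱ j k ≤ ℱ i l)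
    (hind : ∀ i j k, i ≤ j → j ≤ k → Indep (ℱ i j) (ℱ j k) P)
    (hS : ∀ i j, i ≤ j → Measurable[ℱ i j] (S i j))
    {U W : Set G} (hWm : MeasurableSet W) (hWU : ∀ v ∈ W, ∀ w ∈ W, v * w⁻¹ ∈ U)
    (hUm : MeasurableSet U)
    (hmul : ∀ i j k, i ≤ j → j ≤ k → ∀ᵐ ω ∂P, S i j ω * S j k ω = S i k ω)
    {b η : ℝ≥0∞} (hb : 1 ≤ b) (hbη : b * (2 * η) ≤ 1 / 2) {κ : ℕ → ℕ} (hκ : Antitone κ)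
    {L : ℕ} (hη : ∀ i j, i ≤ j → j ≤ L → κ i = κ j → P {ω | S i j ω ∉ W} ≤ η)
    (n i : ℕ) (hi : i ≤ L) :
    ∫⁻ ω, exitWeight S U b L n i ω ∂P ≤ exitBound b (κ i) := by
  have hE : ∀ i j, i ≤ j → MeasurableSet[ℱ i j] (firstExit S U i j) := fun i j hij =>
    measurableSet_firstExit hmono hS hUm hij
  have hZ := fun n i hi => measurable_exitWeight (b := b) (L := L) hmono hE n i hi
  have hEm : ∀ i j, i < j → MeasurableSet (firstExit S U i j) := fun i j hij =>
    hℱ i j hij.le _ (hE i j hij.le)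
  induction n generalizing i with
  | zero =>
    calc ∫⁻ ω, exitWeight S U b L 0 i ω ∂P = 1 := by simp [exitWeight]
      _ ≤ exitBound b 0 := by simp [exitBound]
      _ ≤ _ := exitBound_mono hb zero_le
  | succ n ih =>
    have hterm : ∀ j ∈ Finset.Ioc i L,
        ∫⁻ ω, (firstExit S U i j).indicator (fun ω => b * exitWeight S U b L n j ω) ω ∂P
          ≤ b * (P (firstExit S U i j) * exitBound b (κ j)) := by
      intro j hj
      obtain ⟨hij, hjL⟩ := Finset.mem_Ioc.1 hj
      have hZm : Measurable (exitWeight S U b L n j) := (hZ n j hjL).mono (hℱ j L hjL) le_rfl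
      have e1 : ∀ ω, (firstExit S U i j).indicator (fun ω => b * exitWeight S U b L n j ω) ω =
          b * ((firstExit S U i j).indicator 1 ω * exitWeight S U b L n j ω) := by
        intro ω
        by_cases h : ω ∈ firstExit S U i j <;> simp [h]
      have hI : Measurable[ℱ i j] ((firstExit S U i j).indicator (1 : Ω → ℝ≥0∞)) :=
        Measurable.indicator measurable_const (hE i j hij.le)
      simp_rw [e1]
      rw [lintegral_const_mul b (f := fun ω => (firstExit S U i j).indicator 1 ω *
          exitWeight S U b L n j ω) ((measurable_one.indicator (hEm i j hij)).mul hZm),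
        lintegral_mul_eq_lintegral_mul_lintegral_of_independent_measurableSpace
          (hℱ i j hij.le) (hℱ j L hjL) (hind i j L hij.le hjL)
          hI (hZ n j hjL),
        lintegral_indicator_one (hEm i j hij)]
      gcongr
      exact ih j hjL
    -- `m` is the last index of the block of `i`.
    obtain ⟨m, him, hmL, hm1, hm2⟩ : ∃ m, i ≤ m ∧ m ≤ L ∧ (∀ j, i ≤ j → j ≤ m → κ j = κ i) ∧
        ∀ j, m < j → j ≤ L → κ j < κ i := by
      classical
      have hex : ∃ m, m ≤ L ∧ i ≤ m ∧ κ m = κ i := ⟨i, hi, le_rfl, rfl⟩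
      set m := Nat.findGreatest (fun m => i ≤ m ∧ κ m = κ i) L with hm
      have hsp : i ≤ m ∧ κ m = κ i :=
        Nat.findGreatest_spec (P := fun m => i ≤ m ∧ κ m = κ i) hi ⟨le_rfl, rfl⟩
      refine ⟨m, hsp.1, Nat.findGreatest_le _, fun j h1 h2 => ?_, fun j h1 h2 => ?_⟩
      · exact le_antisymm (hκ h1) (hsp.2 ▸ hκ h2)
      · refine lt_of_le_of_ne (hκ (hsp.1.trans h1.le)) fun h => ?_
        exact Nat.findGreatest_is_greatest h1 h2 ⟨hsp.1.trans h1.le, h⟩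
    have hott : ∑ j ∈ Finset.Ioc i m, P (firstExit S U i j) ≤ 2 * η :=
      sum_measure_firstExit_le hℱ hind hS hWm hWU hE (fun j h1 h2 => hmul i j m h1 h2)
        fun j h1 h2 => hη j m h2 hmL ((hm1 j h1 h2).trans (hm1 m him le_rfl).symm)
    have hsum1 : ∑ j ∈ Finset.Ioc m L, P (firstExit S U i j) ≤ 1 := by
      rw [← measure_biUnion_finset]
      · exact prob_le_one
      · exact pairwise_disjoint_firstExit S U i _ fun j hj =>
          him.trans_lt (Finset.mem_Ioc.1 hj).1
      · exact fun j hj => hEm i j (him.trans_lt (Finset.mem_Ioc.1 hj).1)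
    have hlate : ∑ j ∈ Finset.Ioc m L, P (firstExit S U i j) * exitBound b (κ j) ≤
        if κ i = 0 then 0 else exitBound b (κ i - 1) := by
      split_ifs with h0
      · rw [Finset.sum_eq_zero]
        intro j hj
        have := hm2 j (Finset.mem_Ioc.1 hj).1 (Finset.mem_Ioc.1 hj).2
        omega
      · calc ∑ j ∈ Finset.Ioc m L, P (firstExit S U i j) * exitBound b (κ j)
            ≤ ∑ j ∈ Finset.Ioc m L, P (firstExit S U i j) * exitBound b (κ i - 1) := by
              refine Finset.sum_le_sum fun j hj => mul_le_mul_right (exitBound_mono hb ?_) _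
              have := hm2 j (Finset.mem_Ioc.1 hj).1 (Finset.mem_Ioc.1 hj).2
              omega
          _ ≤ 1 * exitBound b (κ i - 1) := by
              rw [← Finset.sum_mul]
              gcongr
          _ = _ := one_mul _
    have hearly : ∑ j ∈ Finset.Ioc i m, P (firstExit S U i j) * exitBound b (κ j) ≤
        2 * η * exitBound b (κ i) := by
      calc _ = ∑ j ∈ Finset.Ioc i m, P (firstExit S U i j) * exitBound b (κ i) := by
            refine Finset.sum_congr rfl fun j hj => ?_
            rw [hm1 j (Finset.mem_Ioc.1 hj).1.le (Finset.mem_Ioc.1 hj).2]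
        _ ≤ _ := by
            rw [← Finset.sum_mul]
            gcongr
    calc ∫⁻ ω, exitWeight S U b L (n + 1) i ω ∂P
        = 1 + ∑ j ∈ Finset.Ioc i L,
          ∫⁻ ω, (firstExit S U i j).indicator (fun ω => b * exitWeight S U b L n j ω) ω ∂P := by
          simp only [exitWeight]
          rw [lintegral_add_left measurable_const, lintegral_finsetSum]
          · simp
          · intro j hj
            obtain ⟨hij, hjL⟩ := Finset.mem_Ioc.1 hj
            exact (((hZ n j hjL).mono (hℱ j L hjL) le_rfl).const_mul b).indicator (hEm i j hij)
      _ ≤ 1 + ∑ j ∈ Finset.Ioc i L, b * (P (firstExit S U i j) * exitBound b (κ j)) :=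
          add_le_add_right (Finset.sum_le_sum hterm) _
      _ = 1 + b * (∑ j ∈ Finset.Ioc i m, P (firstExit S U i j) * exitBound b (κ j) +
            ∑ j ∈ Finset.Ioc m L, P (firstExit S U i j) * exitBound b (κ j)) := by
          rw [← Finset.mul_sum, Finset.sum_Ioc_consecutive _ him hmL]
      _ ≤ 1 + b * (2 * η * exitBound b (κ i) + if κ i = 0 then 0 else exitBound b (κ i - 1)) := by
          gcongr
      _ ≤ _ := one_add_le_exitBound hbη _

end Exits

/-! ### Regularity of the paths -/

/-- A topological group with a countable basis of neighbourhoods of `1` is pseudometrizable. -/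
lemma pseudoMetrizableSpace_of_topologicalGroup (G : Type*) [TopologicalSpace G] [Group G]
    [IsTopologicalGroup G] [(𝓝 (1 : G)).IsCountablyGenerated] :
    TopologicalSpace.PseudoMetrizableSpace G := by
  let _ : UniformSpace G := IsTopologicalGroup.rightUniformSpace G
  have : (uniformity G).IsCountablyGenerated := comap.isCountablyGenerated _ _
  infer_instance

section Paths

variable {G : Type*} [TopologicalSpace G] [Group G]

/-- The two-parameter path `z` consists of the increments of the right-continuous path `z 0`. -/
structure IsRightContinuousMulPath (z : ℝ≥0 → ℝ≥0 → G) : Prop where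
  eq_inv_mul : ∀ s t, s ≤ t → z s t = (z 0 s)⁻¹ * z 0 t
  right_continuous : ∀ s, ContinuousWithinAt (z 0) (Ici s) s

namespace IsRightContinuousMulPath

variable {z : ℝ≥0 → ℝ≥0 → G}

lemma self_eq_one (hz : IsRightContinuousMulPath z) (s : ℝ≥0) : z s s = 1 := by
  rw [hz.eq_inv_mul s s le_rfl, inv_mul_cancel]

lemma mul_eq (hz : IsRightContinuousMulPath z) {s t u : ℝ≥0} (hst : s ≤ t) (htu : t ≤ u) :
    z s t * z t u = z s u := by
  rw [hz.eq_inv_mul s t hst, hz.eq_inv_mul t u htu, hz.eq_inv_mul s u (hst.trans htu)]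
  group

/-- Joint right-continuity, along sequences or filters that approach `s ≤ t` from the right. -/
lemma tendsto_right [IsTopologicalGroup G] (hz : IsRightContinuousMulPath z) {s t : ℝ≥0}
    (hst : s ≤ t) {ι : Type*} {l : Filter ι} {p q : ι → ℝ≥0} (hp : Tendsto p l (𝓝[≥] s))
    (hq : Tendsto q l (𝓝[≥] t)) (hpq : ∀ᶠ i in l, p i ≤ q i) :
    Tendsto (fun i => z (p i) (q i)) l (𝓝 (z s t)) := by
  rw [hz.eq_inv_mul s t hst]
  have h1 : Tendsto (fun i => z 0 (p i)) l (𝓝 (z 0 s)) := (hz.right_continuous s).tendsto.comp hp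
  have h2 : Tendsto (fun i => z 0 (q i)) l (𝓝 (z 0 t)) := (hz.right_continuous t).tendsto.comp hq
  refine (h1.inv.mul h2).congr' ?_
  filter_upwards [hpq] with i hi
  exact (hz.eq_inv_mul _ _ hi).symm

/-- If all jumps of the path are in `V ^ c`, then all increments over sufficiently short intervals
are in `V ^ (c + 2)`. -/
lemma exists_forall_mem_pow [IsTopologicalGroup G] (hz : IsRightContinuousMulPath z) {V : Set G}
    (hV : IsOpen V) (h1 : (1 : G) ∈ V) (hinv : V⁻¹ = V) {c : ℕ}
    (hjump : ∀ t, 0 < t → ∃ g ∈ V ^ c, Tendsto (fun s => z s t) (𝓝[<] t) (𝓝 g)) (T : ℝ≥0) :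
    ∃ δ > 0, ∀ s t, s ≤ t → t ≤ T → dist s t < δ → z s t ∈ V ^ (c + 2) := by
  have h2 : V ^ 2 ⊆ V ^ (c + 2) := Set.pow_subset_pow_right h1 (by omega)
  have hloc : ∀ a : ℝ≥0, ∃ O : Set ℝ≥0, IsOpen O ∧ a ∈ O ∧
      ∀ s ∈ O, ∀ t ∈ O, s ≤ t → z s t ∈ V ^ (c + 2) := by
    intro a
    have hR : ∀ᶠ s in 𝓝 a, a ≤ s → z a s ∈ V := by
      refine (eventually_nhdsWithin_iff (s := Ici a) (p := fun s => z a s ∈ V)).1 ?_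
      have : Tendsto (fun s => z a s) (𝓝[≥] a) (𝓝 (z a a)) :=
        hz.tendsto_right le_rfl (tendsto_nhdsWithin_iff.2
          ⟨tendsto_const_nhds, Eventually.of_forall fun _ => self_mem_Ici⟩) tendsto_id
          eventually_mem_nhdsWithin
      rw [hz.self_eq_one] at this
      exact this (hV.mem_nhds h1)
    obtain ⟨g, hg, hL⟩ : ∃ g ∈ V ^ c, ∀ᶠ s in 𝓝 a, s < a → z s a ∈ V * {g} := by
      rcases eq_or_lt_of_le (zero_le (a := a)) with rfl | ha
      · exact ⟨1, by simpa using Set.pow_mem_pow (n := c) h1,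
          Eventually.of_forall fun s hs => absurd hs not_lt_zero⟩
      · obtain ⟨g, hg, hlim⟩ := hjump a ha
        refine ⟨g, hg, ?_⟩
        refine (eventually_nhdsWithin_iff (s := Iio a) (p := fun s => z s a ∈ V * {g})).1 ?_
        refine hlim (hV.mul_right.mem_nhds ?_)
        exact ⟨1, h1, g, rfl, one_mul g⟩
    obtain ⟨O, hO, hOo, haO⟩ := eventually_nhds_iff.1 (hR.and hL)
    refine ⟨O, hOo, haO, fun s hs t ht hst => ?_⟩
    rcases lt_or_ge s a with hsa | hsa
    · obtain ⟨v, hv, _, rfl, hvs⟩ := (hO s hs).2 hsa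
      rcases lt_or_ge t a with hta | hta
      · obtain ⟨w, hw, _, rfl, hwt⟩ := (hO t ht).2 hta
        refine h2 ?_
        have : z s t = v * w⁻¹ := by
          have := hz.mul_eq hst hta.le
          simp only at hvs hwt
          rw [← hvs, ← hwt, ← mul_assoc, mul_left_inj] at this
          rw [← this, mul_inv_cancel_right]
        rw [this, pow_two]
        exact Set.mul_mem_mul hv (hinv ▸ Set.inv_mem_inv.2 hw)
      · rw [← hz.mul_eq hsa.le hta, ← hvs, show c + 2 = (1 + c) + 1 by ring, pow_succ, pow_add,
          pow_one]
        exact Set.mul_mem_mul (Set.mul_mem_mul hv hg) ((hO t ht).1 hta)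
    · refine h2 ?_
      have : z s t = (z a s)⁻¹ * z a t := by
        rw [← hz.mul_eq hsa hst, inv_mul_cancel_left]
      rw [this, pow_two]
      exact Set.mul_mem_mul (hinv ▸ Set.inv_mem_inv.2 ((hO s hs).1 hsa))
        ((hO t ht).1 (hsa.trans hst))
  choose O hOo haO hO using hloc
  obtain ⟨δ, hδ, h⟩ := lebesgue_number_lemma_of_metric (isCompact_Icc (a := 0) (b := T)) hOo
    (fun a _ => mem_iUnion.2 ⟨a, haO a⟩)
  refine ⟨δ, hδ, fun s t hst htT hd => ?_⟩
  obtain ⟨a, ha⟩ := h s ⟨zero_le, hst.trans htT⟩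
  exact hO a s (ha (Metric.mem_ball_self hδ)) t (ha (by rwa [Metric.mem_ball, dist_comm])) hst

end IsRightContinuousMulPath

variable {Ω : Type*} [MeasurableSpace Ω] {P : Measure Ω}
  {F : ℝ≥0 → ℝ≥0 → MeasurableSpace Ω} {x : ℝ≥0 → ℝ≥0 → Ω → G} [MeasurableSpace G]

/-- The multiplicativity of `x`, which holds almost surely for fixed times, holds almost surely
for all times at once, by right-continuity in both arguments. -/
lemma IsMultiplicativeProcess.ae_isRightContinuousMulPath [IsTopologicalGroup G] [T2Space G]
    (hx : IsMultiplicativeProcess P F x) (hcadlag : HasCadlagPaths P x) :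
    ∀ᵐ ω ∂P, IsRightContinuousMulPath fun s t => x s t ω := by
  set D : Set ℝ≥0 := range (TopologicalSpace.denseSeq ℝ≥0)
  have hD : Dense D := TopologicalSpace.denseRange_denseSeq ℝ≥0
  have hneBot : ∀ (O : Set ℝ≥0) (s : ℝ≥0), IsOpen O → s ∈ closure O → (𝓝[O ∩ D] s).NeBot := by
    intro O s hO hs
    rw [← mem_closure_iff_nhdsWithin_neBot]
    exact closure_minimal (hD.open_subset_closure_inter hO) isClosed_closure hs
  have hD_mul : ∀ᵐ ω ∂P, ∀ p ∈ D, ∀ q ∈ D, p ≤ q → x 0 p ω * x p q ω = x 0 q ω := by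
    have hDc : D.Countable := countable_range _
    refine (ae_ball_iff hDc).2 fun p _ => (ae_ball_iff hDc).2 fun q _ => ?_
    by_cases hpq : p ≤ q
    · filter_upwards [hx.mul_eq 0 p q zero_le hpq] with ω hω _ using hω
    · exact Eventually.of_forall fun ω h => absurd h hpq
  filter_upwards [hD_mul, hcadlag] with ω hmul hc
  have hright : ∀ s t, s ≤ t → ContinuousWithinAt (fun t => x s t ω) (Ioi t) t := fun s t hst =>
    ((hc.1 s t hst).1).mono fun t' ht' => ⟨hst.trans (le_of_lt ht'), ht'⟩
  have hleft : ∀ s t, s ≤ t → ContinuousWithinAt (fun s => x s t ω) (Iic t ∩ Ioi s) s :=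
    fun s t hst => (hc.2 t s hst).1
  have h1 : ∀ p ∈ D, ∀ t, p ≤ t → x 0 p ω * x p t ω = x 0 t ω := by
    intro p hp t hpt
    have := hneBot (Ioi t) t isOpen_Ioi (by simp)
    refine tendsto_nhds_unique_of_eventuallyEq (l := 𝓝[Ioi t ∩ D] t)
      (((hright p t hpt).mono inter_subset_left).tendsto.const_mul (x 0 p ω))
      ((hright 0 t zero_le).mono inter_subset_left).tendsto ?_
    filter_upwards [self_mem_nhdsWithin] with q hq
    exact hmul p hp q hq.2 (hpt.trans (le_of_lt hq.1))
  have h2 : ∀ s t, s < t → x 0 s ω * x s t ω = x 0 t ω := by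
    intro s t hst
    have := hneBot (Ioo s t) s isOpen_Ioo (by rw [closure_Ioo hst.ne]; exact ⟨le_rfl, hst.le⟩)
    refine tendsto_nhds_unique_of_eventuallyEq (l := 𝓝[Ioo s t ∩ D] s)
      (Tendsto.mul ((hright 0 s zero_le).mono fun q hq => hq.1.1).tendsto
        ((hleft s t hst.le).mono fun q hq => ⟨hq.1.2.le, hq.1.1⟩).tendsto)
      tendsto_const_nhds ?_
    filter_upwards [self_mem_nhdsWithin] with q hq
    exact h1 q hq.2 t hq.1.2.le
  have h3 : ∀ s, x 0 s ω * x s s ω = x 0 s ω := by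
    intro s
    refine tendsto_nhds_unique_of_eventuallyEq
      ((hright s s le_rfl).tendsto.const_mul (x 0 s ω)) (hright 0 s zero_le).tendsto ?_
    filter_upwards [self_mem_nhdsWithin] with q hq
    exact h2 s q hq
  refine ⟨fun s t hst => ?_, fun s => ?_⟩
  · rw [eq_inv_mul_iff_mul_eq]
    rcases hst.eq_or_lt with rfl | h
    · exact h3 s
    · exact h2 s t h
  · exact continuousWithinAt_Ioi_iff_Ici.1 (hright 0 s zero_le)

/-- Stochastic continuity is uniform on bounded time intervals. -/
lemma IsMultiplicativeProcess.exists_forall_measure_notMem_le [BorelSpace G]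
    [IsProbabilityMeasure P] (hF : IsAdditiveFiltration P F) (hx : IsMultiplicativeProcess P F x)
    {W : Set G} (hW : IsOpen W) (h1 : (1 : G) ∈ W) {η : ℝ≥0∞} (hη : 0 < η) (T : ℝ≥0) :
    ∃ h > 0, ∀ s t, s ≤ t → t ≤ T → dist s t < h → P {ω | x s t ω ∉ W} ≤ η := by
  have hloc : ∀ a : ℝ≥0, ∃ ε > 0, ∀ s t, s ≤ t → dist s a < ε → dist t a < ε →
      P {ω | x s t ω ∉ W} ≤ η := by
    intro a
    have hlim := hx.stochastically_continuous a a le_rfl W hW h1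
    have hlt : 1 - η < 1 := ENNReal.sub_lt_self (by simp) (by simp) hη.ne'
    have hev := hlim.eventually_const_lt hlt
    rw [eventually_nhdsWithin_iff, Metric.eventually_nhds_iff] at hev
    obtain ⟨ε, hε, h⟩ := hev
    refine ⟨ε, hε, fun s t hst hs ht => ?_⟩
    have h' := h (y := (s, t)) (by rw [Prod.dist_eq]; exact max_lt hs ht) hst
    have heq : P {ω | (x a a ω)⁻¹ * x s t ω ∈ W} = P {ω | x s t ω ∈ W} := by
      refine measure_congr ?_
      filter_upwards [hx.self_eq a] with ω hω
      refine propext ?_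
      change (x a a ω)⁻¹ * x s t ω ∈ W ↔ x s t ω ∈ W
      rw [hω, inv_one, one_mul]
    simp only [heq] at h'
    have hm : MeasurableSet {ω | x s t ω ∈ W} :=
      hF.le s t hst _ (hx.adapted s t hst hW.measurableSet)
    have hc : {ω | x s t ω ∉ W} = {ω | x s t ω ∈ W}ᶜ := rfl
    rw [hc, prob_compl_eq_one_sub hm]
    exact tsub_le_iff_tsub_le.1 h'.le
  choose ε hε hloc using hloc
  obtain ⟨δ, hδ, h⟩ := lebesgue_number_lemma_of_metric (isCompact_Icc (a := 0) (b := T))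
    (fun a => Metric.isOpen_ball (x := a) (ε := ε a))
    (fun a _ => mem_iUnion.2 ⟨a, Metric.mem_ball_self (hε a)⟩)
  refine ⟨δ, hδ, fun s t hst htT hd => ?_⟩
  obtain ⟨a, ha⟩ := h s ⟨zero_le, hst.trans htT⟩
  exact hloc a s t hst (ha (Metric.mem_ball_self hδ)) (ha (by rwa [Metric.mem_ball, dist_comm]))

end Paths

/-! ### Measurability -/

section Measurability

variable {G : Type*} [TopologicalSpace G] [Group G] [IsTopologicalGroup G]
  [MeasurableSpace G] [BorelSpace G] {Ω : Type*} [MeasurableSpace Ω] {P : Measure Ω}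
  [IsProbabilityMeasure P] {x : ℝ≥0 → ℝ≥0 → Ω → G}

/-- The event that some increment of `x` hits the closed set `C` is null-measurable. By
right-continuity, `x s t ∈ C` if and only if there are dense times to the right of `s` and `t`,
arbitrarily close to them, between which the increment is arbitrarily close to `C`. -/
lemma nullMeasurableSet_hitting [TopologicalSpace.PseudoMetrizableSpace G]
    (hxm : ∀ s t, s ≤ t → Measurable (x s t))
    (hpath : ∀ᵐ ω ∂P, IsRightContinuousMulPath fun s t => x s t ω) (r u : ℝ≥0) {C : Set G}
    (hC : IsClosed C) :
    NullMeasurableSet {ω | ∃ s t, (r < s ∧ s < t ∧ t < u) ∧ x s t ω ∈ C} P := by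
  let _ : PseudoMetricSpace G := TopologicalSpace.pseudoMetrizableSpacePseudoMetric G
  set d := TopologicalSpace.denseSeq ℝ≥0
  have hd : DenseRange d := TopologicalSpace.denseRange_denseSeq ℝ≥0
  set e : ℕ → ℝ≥0 := fun k => 1 / ((k : ℝ≥0) + 1) with he
  have he0 : ∀ k, 0 < e k := fun k => by positivity
  have hetend : Tendsto e atTop (𝓝 0) := tendsto_one_div_add_atTop_nhds_zero_nat
  set p : ℕ → ℝ≥0 := fun j => d (Nat.unpair j).1
  set q : ℕ → ℝ≥0 := fun j => d (Nat.unpair j).2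
  have hopen : IsOpen {w : ℝ≥0 × ℝ≥0 | r < w.1 ∧ w.1 < w.2 ∧ w.2 < u} :=
    (isOpen_Ioi.preimage continuous_fst).inter
      ((isOpen_lt continuous_fst continuous_snd).inter (isOpen_Iio.preimage continuous_snd))
  obtain ⟨R, hRc, -, hRU, -⟩ := hopen.exists_iUnion_isClosed
  have hRcomp : ∀ l, IsCompact (R l) := by
    intro l
    refine (isCompact_Icc (a := ((0 : ℝ≥0), (0 : ℝ≥0))) (b := (u, u))).of_isClosed_subset
      (hRc l) fun w hw => ?_
    have hw' : w ∈ ⋃ l, R l := mem_iUnion.2 ⟨l, hw⟩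
    rw [hRU] at hw'
    exact ⟨⟨zero_le, zero_le⟩, (hw'.2.1.trans hw'.2.2).le, hw'.2.2.le⟩
  set A : ℕ → ℕ → Set Ω := fun k j =>
    {ω | p j ≤ q j ∧ x (p j) (q j) ω ∈ Metric.thickening (e k) C} with hA
  have hAm : ∀ k j, MeasurableSet (A k j) := by
    intro k j
    by_cases h : p j ≤ q j
    · have : A k j = x (p j) (q j) ⁻¹' Metric.thickening (e k) C := by
        ext ω; simp [hA, h]
      rw [this]
      exact hxm _ _ h Metric.isOpen_thickening.measurableSet
    · have : A k j = ∅ := by ext ω; simp [hA, h]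
      rw [this]
      exact MeasurableSet.empty
  set K : ℕ → ℕ → Set (ℝ≥0 × ℝ≥0) := fun k j =>
    {w | (w.1 ≤ p j ∧ p j ≤ w.1 + e k) ∧ (w.2 ≤ q j ∧ q j ≤ w.2 + e k)} with hK
  have hKc : ∀ k j, IsClosed (K k j) := fun k j =>
    ((isClosed_Iic.preimage continuous_fst).inter
      (isClosed_Ici.preimage (continuous_fst.add continuous_const))).inter
      ((isClosed_Iic.preimage continuous_snd).inter
        (isClosed_Ici.preimage (continuous_snd.add continuous_const)))
  have hnull : NullMeasurableSet
      (⋃ l, {ω | ∃ w ∈ R l, ∀ k, ∃ j, ω ∈ A k j ∧ w ∈ K k j}) P :=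
    NullMeasurableSet.iUnion fun l => nullMeasurableSet_proj (hRcomp l) A hAm K hKc
  refine hnull.congr ?_
  filter_upwards [hpath] with ω hω
  refine propext ?_
  change ω ∈ (⋃ l, {ω | ∃ w ∈ R l, ∀ k, ∃ j, ω ∈ A k j ∧ w ∈ K k j}) ↔
    ∃ s t, (r < s ∧ s < t ∧ t < u) ∧ x s t ω ∈ C
  have hiff : ∀ s t, s < t → ((∀ k, ∃ j, ω ∈ A k j ∧ (s, t) ∈ K k j) ↔ x s t ω ∈ C) := by
    intro s t hst
    constructor
    · intro h
      choose j hjA hjK using h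
      have hp : Tendsto (fun k => p (j k)) atTop (𝓝[≥] s) := by
        refine tendsto_nhdsWithin_iff.2 ⟨?_, Eventually.of_forall fun k => (hjK k).1.1⟩
        refine tendsto_of_tendsto_of_tendsto_of_le_of_le tendsto_const_nhds
          (by simpa using hetend.const_add s) (fun k => (hjK k).1.1) fun k => (hjK k).1.2
      have hq : Tendsto (fun k => q (j k)) atTop (𝓝[≥] t) := by
        refine tendsto_nhdsWithin_iff.2 ⟨?_, Eventually.of_forall fun k => (hjK k).2.1⟩
        refine tendsto_of_tendsto_of_tendsto_of_le_of_le tendsto_const_nhds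
          (by simpa using hetend.const_add t) (fun k => (hjK k).2.1) fun k => (hjK k).2.2
      have hlim := hω.tendsto_right hst.le hp hq (Eventually.of_forall fun k => (hjA k).1)
      rw [← hC.closure_eq, Metric.mem_closure_iff_infEDist_zero]
      have h1 := (Metric.continuous_infEDist (s := C)).continuousAt.tendsto.comp hlim
      have h2 : Tendsto (fun k => ENNReal.ofReal (e k)) atTop (𝓝 0) := by
        have : Tendsto (fun k => ((e k : ℝ≥0) : ℝ≥0∞)) atTop (𝓝 ((0 : ℝ≥0) : ℝ≥0∞)) :=
          ENNReal.tendsto_coe.2 hetend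
        simpa using this
      exact le_antisymm (le_of_tendsto_of_tendsto' h1 h2 fun k => (hjA k).2.le) zero_le
    · intro h k
      have h1 : Tendsto (fun w : ℝ≥0 × ℝ≥0 => x w.1 w.2 ω) (𝓝[>] s ×ˢ 𝓝[>] t)
          (𝓝 (x s t ω)) := by
        refine hω.tendsto_right hst.le
          (tendsto_fst.mono_right (nhdsWithin_mono _ Ioi_subset_Ici_self))
          (tendsto_snd.mono_right (nhdsWithin_mono _ Ioi_subset_Ici_self)) ?_
        filter_upwards [prod_mem_prod (mem_nhdsWithin_of_mem_nhds (Iio_mem_nhds hst))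
          self_mem_nhdsWithin] with w hw
        exact (hw.1.trans hw.2).le
      have h2 : ∀ᶠ w in 𝓝[>] s ×ˢ 𝓝[>] t, x w.1 w.2 ω ∈ Metric.thickening (e k) C :=
        h1 (Metric.isOpen_thickening.mem_nhds (Metric.self_subset_thickening
          (by exact_mod_cast he0 k) C h))
      obtain ⟨s', hs', t', ht', hst'⟩ := eventually_prod_iff.1 h2
      have aux : ∀ (a b : ℝ≥0) (pr : ℝ≥0 → Prop), a < b → (∀ᶠ y in 𝓝[>] a, pr y) →
          ∃ i, pr (d i) ∧ a ≤ d i ∧ d i ≤ a + e k ∧ d i ≤ b := by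
        intro a b pr hab hpr
        have h3 : ∀ᶠ y in 𝓝[>] a, pr y ∧ y < a + e k ∧ y < b :=
          hpr.and ((eventually_nhdsWithin_of_eventually_nhds
            (eventually_lt_nhds (lt_add_of_pos_right a (he0 k)))).and
              (eventually_nhdsWithin_of_eventually_nhds (eventually_lt_nhds hab)))
        obtain ⟨c, hc, hsub⟩ := (mem_nhdsGT_iff_exists_Ioo_subset' hab).1 h3
        obtain ⟨i, hy⟩ := hd.exists_mem_open (isOpen_Ioo (a := a) (b := c))
          (nonempty_Ioo.2 hc)
        have := hsub hy
        exact ⟨i, this.1, hy.1.le, this.2.1.le, this.2.2.le⟩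
      obtain ⟨i, hi1, hi2, hi3, hi4⟩ := aux s t s' hst hs'
      obtain ⟨i', hi1', hi2', hi3', -⟩ := aux t (t + 1) t' (by simp) ht'
      refine ⟨Nat.pair i i', ⟨?_, ?_⟩, ⟨?_, ?_⟩, ?_, ?_⟩ <;>
        simp only [p, q, Nat.unpair_pair]
      · exact hi4.trans hi2'
      · exact hst' hi1 hi1'
      all_goals assumption
  simp only [mem_iUnion]
  constructor
  · rintro ⟨l, ⟨s, t⟩, hw, h⟩
    have hw' : (s, t) ∈ ⋃ l, R l := mem_iUnion.2 ⟨l, hw⟩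
    rw [hRU] at hw'
    exact ⟨s, t, hw', (hiff s t hw'.2.1).1 h⟩
  · rintro ⟨s, t, hst, h⟩
    have hw : (s, t) ∈ ⋃ l, R l := by rw [hRU]; exact hst
    obtain ⟨l, hl⟩ := mem_iUnion.1 hw
    exact ⟨l, (s, t), hl, (hiff s t hst.2.1).2 h⟩

end Measurability

/-! ### Word lengths -/

section WordLength

variable {G : Type*} [Group G] {V : Set G}

lemma wordLength_le {g : G} {m : ℕ} (hg : g ∈ V ^ m) : wordLength V g ≤ m :=
  iInf₂_le m hg

lemma wordLength_le_iff (h1 : (1 : G) ∈ V) (g : G) (m : ℕ) :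
    wordLength V g ≤ m ↔ g ∈ V ^ m := by
  constructor
  · intro h
    have hlt : wordLength V g < (m + 1 : ℕ) := h.trans_lt (by exact_mod_cast m.lt_succ_self)
    obtain ⟨k, hk⟩ := iInf_lt_iff.1 hlt
    obtain ⟨hgk, hk⟩ := iInf_lt_iff.1 hk
    have : k ≤ m := Nat.lt_succ_iff.1 (by exact_mod_cast hk)
    exact Set.pow_subset_pow_right h1 this hgk
  · exact wordLength_le

/-- Every level set of the word length is an `F_σ` set: `V ^ m` is open for `m > 0`, and closed
for `m = 0`. -/
lemma isGδ_compl_wordLength_preimage [TopologicalSpace G] [IsTopologicalGroup G] [T2Space G]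
    [PerfectlyNormalSpace G] (hV : IsOpen V) (h1 : (1 : G) ∈ V) (B : Set ℕ∞) :
    IsGδ (wordLength V ⁻¹' B)ᶜ := by
  have hpow : ∀ m : ℕ, IsOpen (V ^ (m + 1)) := fun m => by rw [pow_succ]; exact hV.mul_left
  have hG : ∀ m : ℕ, IsGδ (V ^ m) ∧ IsGδ (V ^ m)ᶜ := by
    intro m
    cases m with
    | zero => exact ⟨by simpa [← Set.singleton_one] using (isClosed_singleton (x := (1 : G))).isGδ,
        by simpa [← Set.singleton_one] using (isOpen_compl_singleton (x := (1 : G))).isGδ⟩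
    | succ m => exact ⟨(hpow m).isGδ, (hpow m).isClosed_compl.isGδ⟩
  have hle : ∀ m : ℕ, {g | wordLength V g ≤ m} = V ^ m := fun m =>
    Set.ext fun g => wordLength_le_iff h1 g m
  have hfib : ∀ k : ℕ∞, IsGδ (wordLength V ⁻¹' {k})ᶜ := by
    intro k
    induction k using ENat.recTopCoe with
    | top =>
      have : (wordLength V ⁻¹' {⊤})ᶜ = ⋃ m, V ^ (m + 1) := by
        ext g
        simp only [mem_compl_iff, mem_preimage, mem_singleton_iff, mem_iUnion, ← hle, mem_ofPred_eq]
        constructor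
        · intro h
          obtain ⟨m, hm⟩ := ENat.ne_top_iff_exists.1 h
          exact ⟨m, by rw [← hm]; exact_mod_cast m.le_succ⟩
        · rintro ⟨m, hm⟩ h
          rw [h] at hm
          exact absurd hm (by simp)
      rw [this]
      exact (isOpen_iUnion hpow).isGδ
    | coe m =>
      cases m with
      | zero =>
        have : wordLength V ⁻¹' {((0 : ℕ) : ℕ∞)} = V ^ 0 := by
          ext g
          rw [← hle]
          simp
        rw [this]
        exact (hG 0).2
      | succ m =>
        have hk : ∀ w : ℕ∞, w = ((m + 1 : ℕ) : ℕ∞) ↔ w ≤ ((m + 1 : ℕ) : ℕ∞) ∧ ¬ w ≤ (m : ℕ) := by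
          intro w
          rw [not_le, ← ENat.add_one_le_iff (by simp), ← Nat.cast_succ]
          exact le_antisymm_iff
        have : (wordLength V ⁻¹' {((m + 1 : ℕ) : ℕ∞)})ᶜ = (V ^ (m + 1))ᶜ ∪ V ^ m := by
          ext g
          simp only [← hle, mem_compl_iff, mem_preimage, mem_singleton_iff, mem_union,
            mem_ofPred_eq]
          rw [hk]
          tauto
        rw [this]
        exact (hG _).2.union (hG _).1
  have : (wordLength V ⁻¹' B)ᶜ = ⋂ k ∈ B, (wordLength V ⁻¹' {k})ᶜ := by
    ext g
    simp only [mem_compl_iff, mem_preimage, mem_iInter, mem_singleton_iff]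
    exact ⟨fun h k hk hgk => h (hgk ▸ hk), fun h hg => h _ hg rfl⟩
  rw [this]
  exact IsGδ.biInter (Set.to_countable B) fun k _ => hfib k

end WordLength

lemma EReal.exp_mul_natCast (α : ℝ) (m : ℕ) :
    EReal.exp ((α : EReal) * (m : EReal)) = ENNReal.ofReal (Real.exp α) ^ m := by
  have : (α : EReal) * (m : EReal) = ((m * α : ℝ) : EReal) := by
    rw [mul_comm]; push_cast; rfl
  rw [this, EReal.exp_coe, Real.exp_nat_mul, ENNReal.ofReal_pow (Real.exp_pos α).le]

lemma exp_mul_wordLength_le {G : Type*} [Group G] {V : Set G} {α : ℝ} (hα : 0 ≤ α) {g : G} {m : ℕ}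
    (hg : g ∈ V ^ m) :
    EReal.exp ((α : EReal) * ((wordLength V g : ℝ≥0∞) : EReal)) ≤
      ENNReal.ofReal (Real.exp α) ^ m := by
  rw [← EReal.exp_mul_natCast]
  refine EReal.exp_monotone (mul_le_mul_of_nonneg_left ?_ (by exact_mod_cast hα))
  have h : wordLength V g ≤ m := wordLength_le hg
  have h' : (wordLength V g : ℝ≥0∞) ≤ ((m : ℕ∞) : ℝ≥0∞) := ENat.toENNReal_le.2 h
  rw [ENat.toENNReal_coe] at h'
  exact (EReal.coe_ennreal_le_coe_ennreal_iff.2 h').trans_eq (by norm_cast)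

lemma supExpWordLength_mono {G : Type*} [Group G] {Ω : Type*} (x : ℝ≥0 → ℝ≥0 → Ω → G)
    (V : Set G) {α β : ℝ} (h : α ≤ β) (r u : ℝ≥0) (ω : Ω) :
    supExpWordLength x V α r u ω ≤ supExpWordLength x V β r u ω := by
  refine iSup_mono fun s => iSup_mono fun t => iSup_mono fun _ => EReal.exp_monotone ?_
  exact mul_le_mul_of_nonneg_right (by exact_mod_cast h) (by exact_mod_cast zero_le)

/-! ### The supremum over all times -/

section Supremum

variable {G : Type*} [TopologicalSpace G] [Group G] [IsTopologicalGroup G] {Ω : Type*}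

/-- The increments over the intervals of a fine grid control all increments: if the increment from
time `0` to each point of the grid of mesh `1 / (n + 1)` is a word of length `k * (c + 1) + 1`
with `b ^ k ≤ Z n`, then the supremum is at most a constant times the lower limit of `Z n`. -/
lemma supExpWordLength_le_liminf {z : ℝ≥0 → ℝ≥0 → Ω → G} {ω : Ω}
    (hz : IsRightContinuousMulPath fun s t => z s t ω) {V : Set G} (hV : IsOpen V)
    (h1 : (1 : G) ∈ V) (hinv : V⁻¹ = V) {c T : ℕ} {u : ℝ≥0} (huT : u ≤ T) {α : ℝ} (hα : 0 ≤ α)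
    {Z : ℕ → ℝ≥0∞}
    (hZ : ∀ᶠ n in atTop, ∀ i ≤ T * (n + 1), ∃ k : ℕ,
      z 0 ((i : ℝ≥0) / ((n : ℝ≥0) + 1)) ω ∈ V ^ (k * (c + 1) + 1) ∧
        (ENNReal.ofReal (Real.exp α) ^ (2 * (c + 1))) ^ k ≤ Z n) (r : ℝ≥0) :
    supExpWordLength z V α r u ω ≤ ENNReal.ofReal (Real.exp α) ^ 3 * liminf Z atTop := by
  set a := ENNReal.ofReal (Real.exp α) with ha
  have ha_top : a ≠ ∞ := ENNReal.ofReal_ne_top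
  refine iSup₂_le fun s t => iSup_le fun hst => ?_
  -- the grid point that follows `s`
  set ι : ℕ → ℝ≥0 → ℕ := fun n s => ⌊s * ((n : ℝ≥0) + 1)⌋₊ + 1 with hι
  set g : ℕ → ℝ≥0 → ℝ≥0 := fun n s => (ι n s : ℝ≥0) / ((n : ℝ≥0) + 1) with hg
  have hn0 : ∀ n : ℕ, (0 : ℝ≥0) < (n : ℝ≥0) + 1 := fun n => by positivity
  have hgt : ∀ n s, s ≤ g n s := by
    intro n s
    rw [hg, le_div_iff₀ (hn0 n)]
    simp only [hι, Nat.cast_add, Nat.cast_one]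
    exact (Nat.lt_floor_add_one _).le
  have hgle : ∀ n s, g n s ≤ s + 1 / ((n : ℝ≥0) + 1) := by
    intro n s
    rw [hg, div_le_iff₀ (hn0 n), add_mul, one_div, inv_mul_cancel₀ (hn0 n).ne']
    simp only [hι, Nat.cast_add, Nat.cast_one]
    gcongr
    exact Nat.floor_le zero_le
  have hgtend : ∀ s, Tendsto (fun n => g n s) atTop (𝓝[≥] s) := by
    intro s
    have h0 : Tendsto (fun n : ℕ => 1 / ((n : ℝ≥0) + 1)) atTop (𝓝 0) :=
      tendsto_one_div_add_atTop_nhds_zero_nat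
    exact tendsto_nhdsWithin_iff.2 ⟨tendsto_of_tendsto_of_tendsto_of_le_of_le tendsto_const_nhds
      (by simpa using h0.const_add s) (fun n => hgt n s) fun n => hgle n s,
      Eventually.of_forall fun n => hgt n s⟩
  have hιmono : ∀ n, ι n s ≤ ι n t := fun n =>
    Nat.add_le_add_right (Nat.floor_mono (by gcongr; exact hst.2.1.le)) 1
  have hgmono : ∀ n, g n s ≤ g n t := fun n => by
    simp only [hg]
    gcongr
    exact hιmono n
  have hιT : ∀ n, ι n t ≤ T * (n + 1) := by
    intro n
    refine Nat.succ_le_of_lt ((Nat.floor_lt zero_le).2 ?_)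
    push_cast
    exact mul_lt_mul_of_pos_right (hst.2.2.trans_le huT) (hn0 n)
  have hlim := hz.tendsto_right hst.2.1.le (hgtend s) (hgtend t)
    (Eventually.of_forall hgmono)
  have hnear : ∀ᶠ n in atTop, z (g n s) (g n t) ω ∈ {z s t ω} * V :=
    hlim (hV.mul_left.mem_nhds ⟨z s t ω, rfl, 1, h1, mul_one _⟩)
  have hle : ∀ᶠ n in atTop,
      EReal.exp ((α : EReal) * ((wordLength V (z s t ω) : ℝ≥0∞) : EReal)) ≤ a ^ 3 * Z n := by
    filter_upwards [hZ, hnear] with n hn hnr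
    obtain ⟨k₁, hk₁, hb₁⟩ := hn (ι n s) ((hιmono n).trans (hιT n))
    obtain ⟨k₂, hk₂, hb₂⟩ := hn (ι n t) (hιT n)
    obtain ⟨k, hk₁', hk₂', hb⟩ : ∃ k, k₁ ≤ k ∧ k₂ ≤ k ∧ (a ^ (2 * (c + 1))) ^ k ≤ Z n := by
      rcases le_total k₁ k₂ with h | h
      · exact ⟨k₂, h, le_rfl, hb₂⟩
      · exact ⟨k₁, le_rfl, h, hb₁⟩
    have hs : z 0 (g n s) ω ∈ V ^ (k * (c + 1) + 1) :=
      Set.pow_subset_pow_right h1 (by gcongr) hk₁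
    have ht : z 0 (g n t) ω ∈ V ^ (k * (c + 1) + 1) :=
      Set.pow_subset_pow_right h1 (by gcongr) hk₂
    have hinvpow : ∀ m : ℕ, (V ^ m)⁻¹ = V ^ m := fun m => by rw [← inv_pow, hinv]
    obtain ⟨_, rfl, v, hv, hvz⟩ := hnr
    have hz' : z s t ω = (z 0 (g n s) ω)⁻¹ * z 0 (g n t) ω * v⁻¹ := by
      rw [← hz.eq_inv_mul _ _ (hgmono n)]
      exact eq_mul_inv_of_mul_eq hvz
    -- two words of length `k * (c + 1) + 1`, and one letter for the distance to the grid increment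
    have hmem : z s t ω ∈ V ^ (2 * (c + 1) * k + 3) := by
      have e : V ^ (2 * (c + 1) * k + 3) =
          V ^ (k * (c + 1) + 1) * V ^ (k * (c + 1) + 1) * V := by
        rw [← pow_add, ← pow_succ]; congr 1; ring
      rw [hz', e]
      refine Set.mul_mem_mul (Set.mul_mem_mul ?_ ht) (hinv ▸ Set.inv_mem_inv.2 hv)
      rw [← hinvpow]
      exact Set.inv_mem_inv.2 hs
    calc _ ≤ a ^ (2 * (c + 1) * k + 3) := exp_mul_wordLength_le hα hmem
      _ = a ^ 3 * (a ^ (2 * (c + 1))) ^ k := by rw [pow_add, pow_mul, mul_comm]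
      _ ≤ _ := by gcongr
  rw [← ENNReal.liminf_const_mul_of_ne_top (ENNReal.pow_ne_top ha_top)]
  exact le_liminf_of_le (by isBoundedDefault) hle

variable [T2Space G] [MeasurableSpace G] [BorelSpace G] [MeasurableSpace Ω] {P : Measure Ω}
  [IsProbabilityMeasure P] {F : ℝ≥0 → ℝ≥0 → MeasurableSpace Ω} {x : ℝ≥0 → ℝ≥0 → Ω → G}

lemma measurable_supExpWordLength [TopologicalSpace.PseudoMetrizableSpace G] [P.IsComplete]
    (hF : IsAdditiveFiltration P F) (hx : IsMultiplicativeProcess P F x)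
    (hcadlag : HasCadlagPaths P x) (r u : ℝ≥0) (α : ℝ) {V : Set G} (hV : IsOpen V)
    (h1 : (1 : G) ∈ V) : Measurable (supExpWordLength x V α r u) := by
  let _ : PseudoMetricSpace G := TopologicalSpace.pseudoMetrizableSpacePseudoMetric G
  refine measurable_of_Ioi fun c => ?_
  set f : ℕ∞ → ℝ≥0∞ := fun k => EReal.exp ((α : EReal) * ((k : ℝ≥0∞) : EReal)) with hf
  obtain ⟨𝒯, h𝒯o, h𝒯c, h𝒯⟩ := isGδ_compl_wordLength_preimage hV h1 (f ⁻¹' Ioi c)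
  have heq : supExpWordLength x V α r u ⁻¹' Ioi c =
      ⋃ O ∈ 𝒯, {ω | ∃ s t, (r < s ∧ s < t ∧ t < u) ∧ x s t ω ∈ Oᶜ} := by
    have hmem : ∀ g, c < f (wordLength V g) ↔ ∃ O ∈ 𝒯, g ∈ Oᶜ := by
      intro g
      have : g ∈ (wordLength V ⁻¹' (f ⁻¹' Ioi c))ᶜ ↔ g ∈ ⋂₀ 𝒯 := by rw [h𝒯]
      rw [← not_iff_not]
      simpa using this
    ext ω
    simp only [supExpWordLength, mem_preimage, mem_Ioi, lt_iSup_iff, mem_iUnion, mem_ofPred_eq]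
    constructor
    · rintro ⟨s, t, hst, h⟩
      obtain ⟨O, hO, hg⟩ := (hmem _).1 h
      exact ⟨O, hO, s, t, hst, hg⟩
    · rintro ⟨O, hO, s, t, hst, hg⟩
      exact ⟨s, t, hst, (hmem _).2 ⟨O, hO, hg⟩⟩
  rw [heq]
  refine MeasurableSet.biUnion h𝒯c fun O hO => ?_
  refine NullMeasurableSet.measurable_of_complete (μ := P) (nullMeasurableSet_hitting
    (fun s t hst => (hx.adapted s t hst).mono (hF.le s t hst) le_rfl)
    (hx.ae_isRightContinuousMulPath hcadlag) r u (h𝒯o O hO).isClosed_compl)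

end Supremum

/-! ### Finiteness of the expectation -/

/-- The expectation is finite if all jumps are in `V ^ c`. -/
lemma lintegral_supExpWordLength_lt_top {G : Type*} [TopologicalSpace G] [Group G]
    [IsTopologicalGroup G] [T2Space G] [MeasurableSpace G] [BorelSpace G] {Ω : Type*}
    [MeasurableSpace Ω] {P : Measure Ω} [IsProbabilityMeasure P]
    {F : ℝ≥0 → ℝ≥0 → MeasurableSpace Ω} {x : ℝ≥0 → ℝ≥0 → Ω → G} (hF : IsAdditiveFiltration P F)
    (hx : IsMultiplicativeProcess P F x) (hcadlag : HasCadlagPaths P x) {V : Set G}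
    (hV : IsOpen V) (h1 : (1 : G) ∈ V) (hinv : V⁻¹ = V) {c : ℕ}
    (hjumps : JumpsBoundedIn P x (V ^ c)) (r u : ℝ≥0) {α : ℝ} (hα : 0 ≤ α) :
    ∫⁻ ω, supExpWordLength x V α r u ω ∂P < ∞ := by
  set a := ENNReal.ofReal (Real.exp α) with ha
  have ha_top : a ≠ ∞ := ENNReal.ofReal_ne_top
  have ha_one : 1 ≤ a := by
    rw [ha, ← ENNReal.ofReal_one]
    exact ENNReal.ofReal_le_ofReal (Real.one_le_exp hα)
  set b := a ^ (2 * ((c + 2) + 1)) with hb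
  have hb_top : b ≠ ∞ := ENNReal.pow_ne_top ha_top
  have hb_one : 1 ≤ b := one_le_pow₀ ha_one
  have hb0 : b ≠ 0 := (zero_lt_one.trans_le hb_one).ne'
  -- The exit probability `2 * η` of a block is so small that `b * (2 * η) = 1 / 2`.
  set η : ℝ≥0∞ := (4 * b)⁻¹ with hη
  have hη0 : 0 < η := ENNReal.inv_pos.2 (ENNReal.mul_ne_top (by simp) hb_top)
  have hbη : b * (2 * η) ≤ 1 / 2 := by
    rw [hη, ENNReal.mul_inv (by simp) (by simp), show (4 : ℝ≥0∞) = 2 * 2 by norm_num,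
      ENNReal.mul_inv (by simp) (by simp)]
    calc b * (2 * (2⁻¹ * 2⁻¹ * b⁻¹)) = (b * b⁻¹) * (2 * 2⁻¹) * 2⁻¹ := by ring
      _ = 1 / 2 := by
        rw [ENNReal.mul_inv_cancel hb0 hb_top, ENNReal.mul_inv_cancel (by simp) (by simp)]
        simp
      _ ≤ _ := le_rfl
  obtain ⟨W₀, hW₀, hW₀V⟩ := exists_nhds_split_inv (hV.mem_nhds h1)
  obtain ⟨W, hWW₀, hW, h1W⟩ := mem_nhds_iff.1 hW₀
  have hWV : ∀ v ∈ W, ∀ w ∈ W, v * w⁻¹ ∈ V := fun v hv w hw => by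
    rw [← div_eq_mul_inv]
    exact hW₀V v (hWW₀ hv) w (hWW₀ hw)
  set T : ℕ := ⌈u⌉₊ with hT
  obtain ⟨h, hh, hstoch⟩ := hx.exists_forall_measure_notMem_le hF hW h1W hη0 T
  -- the grid of mesh `1 / (n + 1)`
  set t : ℕ → ℕ → ℝ≥0 := fun n i => (i : ℝ≥0) / ((n : ℝ≥0) + 1) with ht
  have ht_mono : ∀ n, Monotone (t n) := fun n i j hij => by
    simp only [ht]
    gcongr
  have htT : ∀ n i, i ≤ T * (n + 1) → t n i ≤ T := by
    intro n i hi
    rw [ht, div_le_iff₀ (by positivity)]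
    exact_mod_cast hi
  set S : ℕ → ℕ → ℕ → Ω → G := fun n i j => x (t n i) (t n j) with hS
  set Z : ℕ → Ω → ℝ≥0∞ := fun n =>
    exitWeight (S n) V b (T * (n + 1)) (T * (n + 1)) 0 with hZ
  have hFt : ∀ n i j, i ≤ j → F (t n i) (t n j) ≤ ‹MeasurableSpace Ω› := fun n i j hij =>
    hF.le _ _ (ht_mono n hij)
  have hFmono : ∀ n i j k l, i ≤ j → j ≤ k → k ≤ l →
      F (t n j) (t n k) ≤ F (t n i) (t n l) := fun n i j k l hij hjk hkl =>
    hF.mono _ _ _ _ (ht_mono n hij) (ht_mono n hjk) (ht_mono n hkl)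
  have hSm : ∀ n i j, i ≤ j → Measurable[F (t n i) (t n j)] (S n i j) := fun n i j hij =>
    hx.adapted _ _ (ht_mono n hij)
  -- Blocks are the time intervals `[m h, (m + 1) h)`; `K` is the last one, and `κ n i` counts the
  -- blocks after the one that contains the grid point with index `i`.
  set K : ℕ := ⌊(T : ℝ) / h⌋₊ with hK
  set κ : ℕ → ℕ → ℕ := fun n i => K - ⌊(t n i : ℝ) / h⌋₊ with hκ
  have hκ_anti : ∀ n, Antitone (κ n) := fun n i j hij =>
    Nat.sub_le_sub_left (Nat.floor_mono (by gcongr; exact_mod_cast ht_mono n hij)) K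
  have hblock : ∀ n i j, i ≤ j → j ≤ T * (n + 1) → κ n i = κ n j →
      P {ω | S n i j ω ∉ W} ≤ η := by
    intro n i j hij hj hκij
    have hfl : ∀ i ≤ T * (n + 1), ⌊(t n i : ℝ) / h⌋₊ ≤ K := fun i hi =>
      Nat.floor_mono (by gcongr; exact_mod_cast htT n i hi)
    have heq : ⌊(t n i : ℝ) / h⌋₊ = ⌊(t n j : ℝ) / h⌋₊ := by
      have := hfl i (hij.trans hj)
      have := hfl j hj
      simp only [hκ] at hκij
      omega
    refine hstoch _ _ (ht_mono n hij) (htT n j hj) ?_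
    have hle : (t n i : ℝ) ≤ t n j := by exact_mod_cast ht_mono n hij
    rw [dist_comm, NNReal.dist_eq, abs_of_nonneg (sub_nonneg.2 hle)]
    have h3 := Nat.floor_le (a := (t n i : ℝ) / h) (by positivity)
    have h4 := Nat.lt_floor_add_one ((t n j : ℝ) / h)
    rw [heq, le_div_iff₀ hh] at h3
    rw [div_lt_iff₀ hh] at h4
    linarith
  have hZ_int : ∀ n, ∫⁻ ω, Z n ω ∂P ≤ exitBound b K := by
    intro n
    refine (lintegral_exitWeight_le (ℱ := fun i j => F (t n i) (t n j)) (hFt n) (hFmono n)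
      (fun i j k hij hjk => hF.indep _ _ _ _ (ht_mono n hij) le_rfl (ht_mono n hjk)) (hSm n)
      hW.measurableSet hWV hV.measurableSet
      (fun i j k hij hjk => hx.mul_eq _ _ _ (ht_mono n hij) (ht_mono n hjk)) hb_one hbη
      (hκ_anti n) (hblock n) _ 0 (Nat.zero_le _)).trans (exitBound_mono hb_one (Nat.sub_le _ _))
  have hZ_meas : ∀ n, Measurable (Z n) := by
    intro n
    refine (measurable_exitWeight (ℱ := fun i j => F (t n i) (t n j)) (hFmono n)
      (fun i j hij => ?_) _ 0 (Nat.zero_le _)).mono (hFt n _ _ (Nat.zero_le _)) le_rfl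
    exact measurableSet_firstExit (ℱ := fun i j => F (t n i) (t n j)) (hFmono n) (hSm n)
      hV.measurableSet hij
  have hbound : ∀ᵐ ω ∂P, supExpWordLength x V α r u ω ≤
      a ^ 3 * liminf (fun n => Z n ω) atTop := by
    filter_upwards [hx.ae_isRightContinuousMulPath hcadlag, hjumps.2] with ω hω hj
    obtain ⟨δ, hδ, hstep⟩ := hω.exists_forall_mem_pow hV h1 hinv hj T
    refine supExpWordLength_le_liminf hω hV h1 hinv (Nat.le_ceil u) hα (c := c + 2) ?_ r
    have hsmall : ∀ᶠ n : ℕ in atTop, 1 / ((n : ℝ) + 1) < δ :=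
      tendsto_one_div_add_atTop_nhds_zero_nat.eventually_lt_const hδ
    filter_upwards [hsmall] with n hn i hi
    have := exists_mem_pow_le_exitWeight (S := S n) (U := V) (V := V) subset_rfl h1 b
      (L := T * (n + 1)) (c := c + 2) (ω := ω) (fun i _ => hω.self_eq_one _)
      (fun i j k hij hjk _ => hω.mul_eq (ht_mono n hij) (ht_mono n hjk))
      (fun i hi => hstep _ _ (ht_mono n i.le_succ) (htT n _ hi) ?_)
      (T * (n + 1)) 0 i (Nat.zero_le _) hi (by rwa [Nat.zero_add])
    · simpa [hS, ht] using this
    · refine lt_of_eq_of_lt ?_ hn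
      have hle : (t n i : ℝ) ≤ t n (i + 1) := by exact_mod_cast ht_mono n i.le_succ
      rw [dist_comm, NNReal.dist_eq, abs_of_nonneg (sub_nonneg.2 hle)]
      simp only [ht]
      push_cast
      ring
  calc ∫⁻ ω, supExpWordLength x V α r u ω ∂P
      ≤ ∫⁻ ω, a ^ 3 * liminf (fun n => Z n ω) atTop ∂P := lintegral_mono_ae hbound
    _ = a ^ 3 * ∫⁻ ω, liminf (fun n => Z n ω) atTop ∂P :=
        lintegral_const_mul' _ _ (ENNReal.pow_ne_top ha_top)
    _ ≤ a ^ 3 * liminf (fun n => ∫⁻ ω, Z n ω ∂P) atTop := by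
        gcongr
        exact lintegral_liminf_le hZ_meas
    _ ≤ a ^ 3 * exitBound b K := by
        gcongr
        exact liminf_le_of_le (by isBoundedDefault) fun y hy => by
          obtain ⟨n, hn⟩ := hy.exists
          exact hn.trans (hZ_int n)
    _ < ∞ := ENNReal.mul_lt_top (ENNReal.pow_lt_top ha_top.lt_top)
        (exitBound_ne_top hb_top K).lt_top

theorem mainTheorem2
    {E : Type*} [NormedAddCommGroup E] [NormedSpace ℝ E] [CompleteSpace E]
    {G : Type*} [TopologicalSpace G] [T2Space G] [TopologicalSpace.SeparableSpace G]
    [ChartedSpace E G] [Group G] [LieGroup 𝓘(ℝ, E) (⊤ : ℕ∞) G]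
    [MeasurableSpace G] [BorelSpace G]
    {Ω : Type*} [MeasurableSpace Ω] (P : Measure Ω) [IsProbabilityMeasure P] [P.IsComplete]
    (F : ℝ≥0 → ℝ≥0 → MeasurableSpace Ω) (hF : IsAdditiveFiltration P F)
    (x : ℝ≥0 → ℝ≥0 → Ω → G) (hx : IsMultiplicativeProcess P F x)
    (hcadlag : HasCadlagPaths P x) (hjumps : HasBoundedJumps E P x)
    (r u : ℝ≥0) (hr : 0 < r) (hru : r < u) (α : ℝ)
    (V : Set G) (hV : IsOpen V) (heV : (1 : G) ∈ V) :
    Measurable (supExpWordLength x V α r u) ∧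
      ∫⁻ ω, supExpWordLength x V α r u ω ∂P < ∞ := by
  have := topologicalGroup_of_lieGroup 𝓘(ℝ, E) (⊤ : ℕ∞) (G := G)
  have : (𝓝 (1 : G)).IsCountablyGenerated := by
    rw [← (chartAt E (1 : G)).symm_map_nhds_eq (mem_chart_source E (1 : G))]
    infer_instance
  have := pseudoMetrizableSpace_of_topologicalGroup G
  refine ⟨measurable_supExpWordLength hF hx hcadlag r u α hV heV, ?_⟩
  -- Pass to a symmetric neighbourhood and to a nonnegative exponent.
  set V' : Set G := V ∩ V⁻¹ with hV'
  have hV'o : IsOpen V' := hV.inter hV.inv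
  have h1V' : (1 : G) ∈ V' := ⟨heV, by simpa using heV⟩
  have hinv : V'⁻¹ = V' := by rw [hV', Set.inter_inv, inv_inv, inter_comm]
  obtain ⟨δ, -, n, h1A, hA⟩ := hjumps
  obtain ⟨c, hc⟩ := exists_expBall_subset_pow (E := E) δ (hV'o.mem_nhds h1V')
  have hsub : expBall E G δ ^ n ⊆ V' ^ (c * n) := by
    rw [pow_mul]
    exact Set.pow_subset_pow_left hc
  have hJ : JumpsBoundedIn P x (V' ^ (c * n)) := by
    refine ⟨hsub h1A, ?_⟩
    filter_upwards [hA] with ω hω t ht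
    obtain ⟨g, hg, hlim⟩ := hω t ht
    exact ⟨g, hsub hg, hlim⟩
  have hmonoV : ∀ ω, supExpWordLength x V (max α 0) r u ω ≤
      supExpWordLength x V' (max α 0) r u ω := by
    intro ω
    refine iSup_mono fun s => iSup_mono fun t => iSup_mono fun _ => EReal.exp_monotone ?_
    refine mul_le_mul_of_nonneg_left ?_ (by exact_mod_cast le_max_right α 0)
    refine EReal.coe_ennreal_le_coe_ennreal_iff.2 (ENat.toENNReal_le.2 ?_)
    exact le_iInf₂ fun m hm => wordLength_le (Set.pow_subset_pow_left inter_subset_left hm)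
  exact (lintegral_mono fun ω => (supExpWordLength_mono x V (le_max_left α 0) r u ω).trans
    (hmonoV ω)).trans_lt (lintegral_supExpWordLength_lt_top hF hx hcadlag hV'o h1V' hinv hJ r u
      (le_max_right α 0))
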